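/- Let $N\ge 1$ be an integer and put $p^*=\frac{Np}{N-p}$ if $1\le p<N$, $p^*=\infty$ if $p>N$; for $p=N$, "$q\le p^*$" and "$q<p^*$" just mean that $q$ is finite. Let $\Omega\subseteq\mathbb R^N$ be open with finite measure, $p\in[1,\infty)$, and let $W^{1,p}_0(\Omega)$ be the closure of $C_c^\infty(\Omega)$ with respect to $\|Du\|_{L^p}$. Let $H:\mathbb R^N\to[0,\infty)$ be convex with $H(z)\ge c|z|^p$ for some $c>0$ and all $z$. Let $f:\Omega\times\mathbb R\to\mathbb R$ be a Carathéodory function with $\sup_{|s|\le t}\|f(\cdot,s)\|_{L^\infty(\Omega)}<\infty$ for all $t>0$, and let $F(x,t)=\int_0^t f(x,s)\,ds$. For given $\mu,\theta\ge 0$ and finite $q\ge 1$ consider the growth condition $$\operatorname{sign}(t)\,f(x,t)\le \mu\,(|t|+\theta)^{q-1}\qquad\text{for a.e. }x\in\Omega\text{ and all }t\in\mathbb R.\tag{G}$$ A function $u\in W^{1,p}_0(\Omega)$ is an energy critical point of $J(v)=\int_\Omega H(Dv)-F(x,v)\,dx$ if $J(u)<\infty$, $f(\cdot,u)u\in L^1(\Omega)$,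 and $u$ minimises $$J_u(v)=\int_\Omega H(Dv)-f(x,u)\,v\,dx\in(-\infty,\infty]$$ among all $v\in W^{1,p}_0(\Omega)$ with $f(\cdot,u)v\in L^1(\Omega)$. (1) Assume, if $p\le N$, that (G) holds for some $\mu,\theta\ge0$ and some finite $q$ with $1\le q\le p^*$ (if $p>N$, (G) is not assumed). Then every energy critical point of $J$ belongs to $L^\infty(\Omega)$. (2) There is a positive continuous function $(p,q)\mapsto C(N,p,q)$ on $\{(p,q):p\ge 1,\ 1\le q<p^*\}$, depending only on $N$, such that, whenever $\Omega,p,H,c,f$ are as above, $H(0)=0$, and (G) holds with some $\mu,\theta\ge 0$ and some finite $q$ with $1\le q<p^*$, every energy critical point $u$ of $J$ satisfies $u\in L^q(\Omega)$ and $$\|u\|_{L^\infty(\Omega)}\le\max\left\{\theta,\;C(N,p,q)\left(\Big(\frac{\mu}{c}\Big)^{\frac Np}\int_\Omega|u|^q\,dx\right)^{\frac{p}{pq+(p-q)N}}\right\}.$$ -/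

import Mathlib

open MeasureTheory Filter
open scoped ContDiff Topology

/-- The space `ℝᴺ` with its Euclidean norm. -/
abbrev RN (N : ℕ) : Type := EuclideanSpace ℝ (Fin N)

/-- The integral `∫ g dm ∈ [-∞, ∞]` of a real function, as the integral of the positive part minus
the integral of the negative part. It is meaningful when one of the two is finite. -/
noncomputable def extIntegral {α : Type*} [MeasurableSpace α] (m : Measure α) (g : α → ℝ) : EReal :=
  ((∫⁻ x, ENNReal.ofReal (g x) ∂m : ENNReal) : EReal) -
    ((∫⁻ x, ENNReal.ofReal (-g x) ∂m : ENNReal) : EReal)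

/-- The critical exponent `p*`: it is `N p / (N - p)` if `p < N`, and `∞` otherwise. For `p = N`,
where `p*` may be any finite number, a real `q` satisfies `q ≤ p*` (or `q < p*`) for some choice of
the finite number exactly when `q < ∞`, so that the value `∞` expresses this for real `q`. -/
noncomputable def critExp (N : ℕ) (p : ℝ) : EReal :=
  if p < (N : ℝ) then (((N : ℝ) * p / ((N : ℝ) - p) : ℝ) : EReal) else ⊤

/-- `u ∈ W^{1,p}_0(Ω)` with weak gradient `Du`: the pair `(u, Du)` is in the closure of the pairs
`(φ, ∇φ)`, `φ ∈ C_c^∞(Ω)`, in `L^p(Ω) × L^p(Ω)^N`. The function `u` determines `Du` almost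
everywhere in `Ω`. If `Ω` has finite measure then, by the Poincaré inequality, this is the closure
of `C_c^∞(Ω)` with respect to `‖Du‖_p`. -/
structure MemW0 {N : ℕ} (Ω : Set (RN N)) (p : ℝ) (u : RN N → ℝ) (Du : RN N → RN N) : Prop where
  memLp : MemLp u (ENNReal.ofReal p) (volume.restrict Ω)
  memLp_grad : MemLp Du (ENNReal.ofReal p) (volume.restrict Ω)
  approx : ∃ φ : ℕ → RN N → ℝ,
    (∀ n, ContDiff ℝ ∞ (φ n) ∧ HasCompactSupport (φ n) ∧ tsupport (φ n) ⊆ Ω) ∧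
    Tendsto (fun n => eLpNorm (fun x => φ n x - u x) (ENNReal.ofReal p) (volume.restrict Ω))
      atTop (𝓝 0) ∧
    Tendsto (fun n => eLpNorm (fun x => gradient (φ n) x - Du x) (ENNReal.ofReal p)
      (volume.restrict Ω)) atTop (𝓝 0)

/-- `f : Ω × ℝ → ℝ` is a Carathéodory function: (Lebesgue) measurable in `x`, continuous in `t`. -/
structure IsCaratheodory {N : ℕ} (Ω : Set (RN N)) (f : RN N → ℝ → ℝ) : Prop where
  aemeasurable : ∀ t : ℝ, AEMeasurable (fun x => f x t) (volume.restrict Ω)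
  continuous : ∀ᵐ x ∂(volume.restrict Ω), Continuous (f x)

/-- `sup_{|s| ≤ t} ‖f(·, s)‖_{L^∞(Ω)} < ∞` for all `t > 0`. -/
def LocBounded {N : ℕ} (Ω : Set (RN N)) (f : RN N → ℝ → ℝ) : Prop :=
  ∀ t : ℝ, 0 < t → ∃ M : ℝ, ∀ s : ℝ, |s| ≤ t → ∀ᵐ x ∂(volume.restrict Ω), |f x s| ≤ M

/-- `sign(t) f(x, t) ≤ μ (|t| + θ)^{q - 1}` for almost every `x ∈ Ω` and all `t`. -/
def OneSidedGrowth {N : ℕ} (Ω : Set (RN N)) (f : RN N → ℝ → ℝ) (μ θ q : ℝ) : Prop :=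
  ∀ᵐ x ∂(volume.restrict Ω), ∀ t : ℝ, Real.sign t * f x t ≤ μ * (|t| + θ) ^ (q - 1)

/-- The standing assumptions: `Ω` is open with finite measure, `p ≥ 1`, `H` is convex with
`H(z) ≥ c |z|^p` for some `c > 0` (so `H ≥ 0`), and `f` is Carathéodory and locally bounded. -/
structure Standing {N : ℕ} (Ω : Set (RN N)) (p c : ℝ) (H : RN N → ℝ) (f : RN N → ℝ → ℝ) :
    Prop where
  isOpen : IsOpen Ω
  finite_measure : volume Ω < ⊤
  one_le : 1 ≤ p
  c_pos : 0 < c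
  convex : ConvexOn ℝ Set.univ H
  coercive : ∀ z, c * ‖z‖ ^ p ≤ H z
  caratheodory : IsCaratheodory Ω f
  locBounded : LocBounded Ω f

/-- `J(v) = ∫_Ω H(Dv) - F(x, v) dx`, where `F(x, t) = ∫_0^t f(x, s) ds`. -/
noncomputable def energyJ {N : ℕ} (Ω : Set (RN N)) (H : RN N → ℝ) (f : RN N → ℝ → ℝ)
    (v : RN N → ℝ) (Dv : RN N → RN N) : EReal :=
  extIntegral (volume.restrict Ω) (fun x => H (Dv x) - ∫ s in (0 : ℝ)..(v x), f x s)

/-- The semi-linearised functional `J_u(v) = ∫_Ω H(Dv) - f(x, u) v dx`. -/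
noncomputable def linearizedJ {N : ℕ} (Ω : Set (RN N)) (H : RN N → ℝ) (f : RN N → ℝ → ℝ)
    (u v : RN N → ℝ) (Dv : RN N → RN N) : EReal :=
  extIntegral (volume.restrict Ω) (fun x => H (Dv x) - f x (u x) * v x)

/-- `v ∈ V_u`, that is `v ∈ W^{1,p}_0(Ω)` (with gradient `Dv`) and `f(·, u) v ∈ L^1(Ω)`. -/
def MemV {N : ℕ} (Ω : Set (RN N)) (p : ℝ) (f : RN N → ℝ → ℝ)
    (u v : RN N → ℝ) (Dv : RN N → RN N) : Prop :=
  MemW0 Ω p v Dv ∧ Integrable (fun x => f x (u x) * v x) (volume.restrict Ω)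

/-- `u ∈ W^{1,p}_0(Ω)`, with weak gradient `Du`, is an energy critical point of `J`: `J(u) < ∞` and
`u` minimises `J_u` on `V_u`. -/
structure IsEnergyCritical {N : ℕ} (Ω : Set (RN N)) (p : ℝ) (H : RN N → ℝ) (f : RN N → ℝ → ℝ)
    (u : RN N → ℝ) (Du : RN N → RN N) : Prop where
  energy_lt_top : energyJ Ω H f u Du < ⊤
  mem : MemV Ω p f u u Du
  minimal : ∀ (v : RN N → ℝ) (Dv : RN N → RN N), MemV Ω p f u v Dv →
    linearizedJ Ω H f u u Du ≤ linearizedJ Ω H f u v Dv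

/-- The set of the pairs `(p, q)` with `p ≥ 1` and `1 ≤ q < p*`. -/
def subcritical (N : ℕ) : Set (ℝ × ℝ) :=
  {z | 1 ≤ z.1 ∧ 1 ≤ z.2 ∧ (z.2 : EReal) < critExp N z.1}

/-!
Comparing `u` with its truncation at the levels `± k` bounds the energy of `u` above the level `k`
by `∫ f(x, u) (u - trunc k u)`, so that only the one-sided growth of `f` matters. The Sobolev
inequality turns this into a bound of a power of `φ k = ∫ (|u| - k)⁺` by a power of the measure
`A k` of `{|u| > k}`. As `φ' = -A`, this is a differential inequality for `φ`; if the exponent of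
`φ` is less than that of `A`, then `φ` vanishes beyond an explicit finite level, which bounds `|u|`.

At the critical growth exponent, the moment `∫ ((|u| - k)⁺) ^ r` on the right-hand side is absorbed
into the left-hand side, because it tends to `0` as `k → ∞`. For the quantitative estimate one
bounds `f(x, u)` by `μ (2 ‖u‖_∞) ^ (q - 1)` if `θ < ‖u‖_∞`, and `φ` at the level `‖u‖_∞ / 2` by
`∫ |u| ^ q`; that `φ` cannot vanish before `‖u‖_∞` then bounds `‖u‖_∞`.
-/

section Extinction

variable {φ A K : ℝ → ℝ} {k L : ℝ}

theorem apply_add_le_of_apply_le_two_mul (hφ : ∀ a b, a ≤ b → φ b + (b - a) * A b ≤ φ a)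
    (hA : ∀ h, 0 ≤ A h) (hKanti : AntitoneOn (fun s => K s / s) (Set.Ioi 0)) {a s : ℝ}
    (hs : 0 < s) (hKs : 0 ≤ K s) (ha : φ a ≤ 2 * s)
    (hb : 0 < φ (a + K s) → φ (a + K s) ≤ K (φ (a + K s)) * A (a + K s)) :
    φ (a + K s) ≤ s := by
  by_contra! hlt
  have hpos : 0 < φ (a + K s) := hs.trans hlt
  have hKφ : K (φ (a + K s)) / φ (a + K s) ≤ K s / s := hKanti hs hpos hlt.le
  have hsA : s ≤ K s * A (a + K s) := by
    have : 1 ≤ K s / s * A (a + K s) :=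
      calc 1 ≤ K (φ (a + K s)) * A (a + K s) / φ (a + K s) := (one_le_div hpos).2 (hb hpos)
        _ = K (φ (a + K s)) / φ (a + K s) * A (a + K s) := by ring
        _ ≤ K s / s * A (a + K s) := mul_le_mul_of_nonneg_right hKφ (hA _)
    rwa [div_mul_eq_mul_div, one_le_div hs] at this
  have := hφ a (a + K s) (by linarith)
  rw [add_sub_cancel_left] at this
  linarith

-- From `a` to `a + K s` the function drops from at most `2 s` to at most `s`; starting from `φ k`
-- and halving forever, the total length of the steps is the sum in `hL`.
theorem eq_zero_of_le_mul_decrease (hφ0 : ∀ h, 0 ≤ φ h)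
    (hφ : ∀ a b, a ≤ b → φ b + (b - a) * A b ≤ φ a) (hA : ∀ h, 0 ≤ A h)
    (hK0 : ∀ s, 0 < s → 0 ≤ K s) (hKanti : AntitoneOn (fun s => K s / s) (Set.Ioi 0))
    (hφK : ∀ h ∈ Set.Icc k L, 0 < φ h → φ h ≤ K (φ h) * A h)
    (hL : ∀ n : ℕ, k + ∑ i ∈ Finset.range n, K (φ k / 2 ^ (i + 1)) ≤ L) : φ L = 0 := by
  have anti : Antitone φ := fun a b hab => by
    linarith [hφ a b hab, mul_nonneg (sub_nonneg.2 hab) (hA b)]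
  refine le_antisymm ?_ (hφ0 L)
  rcases (hφ0 k).eq_or_lt with h0 | h0
  · exact h0 ▸ anti (by simpa using hL 0)
  set κ : ℕ → ℝ := fun n => k + ∑ i ∈ Finset.range n, K (φ k / 2 ^ (i + 1)) with hκ
  have hK' : ∀ n : ℕ, 0 ≤ K (φ k / 2 ^ (n + 1)) := fun n => hK0 _ (by positivity)
  have halving : ∀ n, φ (κ n) ≤ φ k / 2 ^ n := by
    intro n
    induction n with
    | zero => simp [hκ]
    | succ n ih =>
      have hsucc : κ (n + 1) = κ n + K (φ k / 2 ^ (n + 1)) := by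
        simp only [hκ, Finset.sum_range_succ, add_assoc]
      have hk : k ≤ κ (n + 1) := le_add_of_nonneg_right (Finset.sum_nonneg fun i _ => hK' i)
      rw [hsucc] at hk ⊢
      exact apply_add_le_of_apply_le_two_mul hφ hA hKanti (by positivity) (hK' n)
        (ih.trans_eq (by field_simp; ring)) (hφK _ ⟨hk, hsucc ▸ hL (n + 1)⟩)
  have hlim : Tendsto (fun n : ℕ => φ k / 2 ^ n) atTop (𝓝 0) :=
    tendsto_const_nhds.div_atTop (tendsto_pow_atTop_atTop_of_one_lt one_lt_two)
  exact ge_of_tendsto' hlim fun n => (anti (hL n)).trans (halving n)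

theorem two_rpow_sub_one_pos {β : ℝ} (hβ : 0 < β) : 0 < (2 : ℝ) ^ β - 1 :=
  sub_pos.2 (Real.one_lt_rpow one_lt_two hβ)

theorem sum_rpow_div_two_pow_le {x β : ℝ} (hx : 0 ≤ x) (hβ : 0 < β) (n : ℕ) :
    ∑ i ∈ Finset.range n, (x / 2 ^ (i + 1)) ^ β ≤ x ^ β / (2 ^ β - 1) := by
  have hd := two_rpow_sub_one_pos hβ
  have telescope : ∑ i ∈ Finset.range n, (x / 2 ^ (i + 1)) ^ β + (x / 2 ^ n) ^ β / (2 ^ β - 1)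
      = x ^ β / (2 ^ β - 1) := by
    induction n with
    | zero => simp
    | succ n ih =>
      have : (x / 2 ^ n) ^ β = 2 ^ β * (x / 2 ^ (n + 1)) ^ β := by
        rw [← Real.mul_rpow zero_le_two (by positivity)]
        congr 1
        field_simp
        ring
      rw [← ih, Finset.sum_range_succ, this]
      field_simp
      ring
  have : 0 ≤ (x / 2 ^ n) ^ β / (2 ^ β - 1) := by positivity
  linarith

theorem eq_zero_of_le_rpow_mul_decrease {β₁ β₂ K₁ K₂ : ℝ} (hφ0 : ∀ h, 0 ≤ φ h)
    (hφ : ∀ a b, a ≤ b → φ b + (b - a) * A b ≤ φ a) (hA : ∀ h, 0 ≤ A h)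
    (hβ₁ : 0 < β₁) (hβ₁' : β₁ ≤ 1) (hβ₂ : 0 < β₂) (hβ₂' : β₂ ≤ 1) (hK₁ : 0 ≤ K₁) (hK₂ : 0 ≤ K₂)
    (hφK : ∀ h ∈ Set.Icc k L, 0 < φ h → φ h ≤ (K₁ * φ h ^ β₁ + K₂ * φ h ^ β₂) * A h)
    (hL : k + (K₁ * (φ k ^ β₁ / (2 ^ β₁ - 1)) + K₂ * (φ k ^ β₂ / (2 ^ β₂ - 1))) ≤ L) :
    φ L = 0 := by
  refine eq_zero_of_le_mul_decrease (K := fun s => K₁ * s ^ β₁ + K₂ * s ^ β₂) hφ0 hφ hA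
    (fun s hs => by positivity) (fun s hs t ht hst => ?_) hφK fun n => hL.trans' ?_
  · rw [Set.mem_Ioi] at hs ht
    simp only [add_div, mul_div_assoc, ← Real.rpow_sub_one hs.ne', ← Real.rpow_sub_one ht.ne']
    gcongr ?_ * ?_ + ?_ * ?_
    · exact Real.rpow_le_rpow_of_nonpos hs hst (by linarith)
    · exact Real.rpow_le_rpow_of_nonpos hs hst (by linarith)
  · rw [Finset.sum_add_distrib, ← Finset.mul_sum, ← Finset.mul_sum]
    gcongr
    · exact sum_rpow_div_two_pow_le (hφ0 k) hβ₁ n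
    · exact sum_rpow_div_two_pow_le (hφ0 k) hβ₂ n

theorem le_rpow_mul_of_rpow_le {x y a b B : ℝ} (hx : 0 < x) (hy : 0 ≤ y) (hB : 0 ≤ B)
    (hb : 0 < b) (h : x ^ a ≤ B * y ^ b) : x ≤ B ^ (1 / b) * x ^ (1 - a / b) * y := by
  have hroot : x ^ (a / b) ≤ B ^ (1 / b) * y :=
    calc x ^ (a / b) = (x ^ a) ^ (1 / b) := by rw [← Real.rpow_mul hx.le, mul_one_div]
      _ ≤ (B * y ^ b) ^ (1 / b) := by gcongr
      _ = B ^ (1 / b) * y := by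
        rw [Real.mul_rpow hB (by positivity), ← Real.rpow_mul hy, mul_one_div_cancel hb.ne',
          Real.rpow_one]
  calc x = x ^ (a / b) * x ^ (1 - a / b) := by rw [← Real.rpow_add hx]; simp
    _ ≤ B ^ (1 / b) * y * x ^ (1 - a / b) := by gcongr
    _ = _ := by ring

end Extinction

section Excess

theorem support_max_sub_subset {α : Type*} (u : α → ℝ) (k : ℝ) :
    Function.support (fun x => max (|u x| - k) 0) ⊆ {x | k < |u x|} :=
  fun x hx => by
    rw [Function.mem_support, ne_eq, max_eq_right_iff, not_le, sub_pos] at hx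
    exact hx

variable {α : Type*} [MeasurableSpace α] {m : Measure α} {u : α → ℝ} {r k : ℝ}

/-- The moment of order `r` of the excess `(|u| - k)⁺` of `|u|` over the level `k`. -/
noncomputable def excess (m : Measure α) (u : α → ℝ) (r k : ℝ) : ℝ :=
  ∫ x, max (|u x| - k) 0 ^ r ∂m

/-- The measure of the superlevel set `{|u| > k}`; up to its sign it is the derivative of
`excess m u 1` at `k`. -/
noncomputable def levelMeas (m : Measure α) (u : α → ℝ) (k : ℝ) : ℝ := m.real {x | k < |u x|}

theorem excess_nonneg : 0 ≤ excess m u r k :=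
  integral_nonneg fun _ => Real.rpow_nonneg (le_max_right _ _) _

theorem levelMeas_nonneg : 0 ≤ levelMeas m u k := measureReal_nonneg

theorem excess_one : excess m u 1 k = ∫ x, max (|u x| - k) 0 ∂m := by
  simp only [excess, Real.rpow_one]

theorem excess_zero_right : excess m u r 0 = ∫ x, |u x| ^ r ∂m := by
  simp only [excess, sub_zero, max_eq_left (abs_nonneg (_ : ℝ))]

theorem nullMeasurableSet_level (hu : AEStronglyMeasurable u m) (k : ℝ) :
    NullMeasurableSet {x | k < |u x|} m :=
  nullMeasurableSet_lt aemeasurable_const hu.norm.aemeasurable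

theorem eLpNorm_le_mul_rpow_of_support_subset {E : Type*} [NormedAddCommGroup E] {w : α → E}
    {s : Set α} {p q : ENNReal} (hpq : p ≤ q) (hw : AEStronglyMeasurable w m)
    (hs : Function.support w ⊆ s) :
    eLpNorm w p m ≤ eLpNorm w q m * m s ^ (1 / p.toReal - 1 / q.toReal) := by
  have := eLpNorm_le_eLpNorm_mul_rpow_measure_univ hpq (hw.restrict (s := s))
  rwa [eLpNorm_restrict_eq_of_support_subset hs, eLpNorm_restrict_eq_of_support_subset hs,
    Measure.restrict_apply_univ] at this

variable [IsFiniteMeasure m]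

theorem ofReal_levelMeas : ENNReal.ofReal (levelMeas m u k) = m {x | k < |u x|} :=
  ofReal_measureReal

theorem memLp_max_sub {q : ENNReal} (hu : MemLp u q m) (k : ℝ) :
    MemLp (fun x => max (|u x| - k) 0) q m :=
  (hu.abs.sub (memLp_const k)).pos_part

theorem integrable_max_sub_rpow (hr : 0 < r) (hu : MemLp u (ENNReal.ofReal r) m) (k : ℝ) :
    Integrable (fun x => max (|u x| - k) 0 ^ r) m := by
  have := (memLp_max_sub hu k).integrable_norm_rpow (by simpa using hr) ENNReal.ofReal_ne_top
  simpa [ENNReal.toReal_ofReal hr.le, abs_of_nonneg (le_max_right _ (0 : ℝ))] using this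

theorem integrable_max_sub (hu : Integrable u m) (k : ℝ) :
    Integrable (fun x => max (|u x| - k) 0) m :=
  memLp_one_iff_integrable.1 (memLp_max_sub (memLp_one_iff_integrable.2 hu) k)

theorem eLpNorm_max_sub (hr : 0 < r) (hu : MemLp u (ENNReal.ofReal r) m) (k : ℝ) :
    eLpNorm (fun x => max (|u x| - k) 0) (ENNReal.ofReal r) m
      = ENNReal.ofReal (excess m u r k ^ (1 / r)) := by
  rw [(memLp_max_sub hu k).eLpNorm_eq_integral_rpow_norm (by simpa using hr) ENNReal.ofReal_ne_top]
  simp [ENNReal.toReal_ofReal hr.le, abs_of_nonneg (le_max_right _ (0 : ℝ)), excess]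

theorem excess_one_le (hr : 1 ≤ r) (hu : MemLp u (ENNReal.ofReal r) m) (k : ℝ) :
    excess m u 1 k ≤ excess m u r k ^ (1 / r) * levelMeas m u k ^ (1 - 1 / r) := by
  have hr' : (1 : ENNReal) ≤ ENNReal.ofReal r := by simpa using hr
  have hu1 : MemLp u (ENNReal.ofReal 1) m := hu.mono_exponent (by simpa using hr)
  have hexp : 0 ≤ 1 - 1 / r := sub_nonneg.2 ((div_le_one (by linarith)).2 hr)
  have holder := eLpNorm_le_mul_rpow_of_support_subset hr' (memLp_max_sub hu k).1
    (support_max_sub_subset u k)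
  have hone := eLpNorm_max_sub one_pos hu1 k
  rw [ENNReal.ofReal_one, div_one, Real.rpow_one] at hone
  rw [hone, eLpNorm_max_sub (by linarith) hu k, ← ofReal_levelMeas, ENNReal.toReal_one, div_one,
    ENNReal.toReal_ofReal (by linarith), ENNReal.ofReal_rpow_of_nonneg levelMeas_nonneg hexp,
    ← ENNReal.ofReal_mul (Real.rpow_nonneg excess_nonneg _)] at holder
  exact (ENNReal.ofReal_le_ofReal_iff (mul_nonneg (Real.rpow_nonneg excess_nonneg _)
    (Real.rpow_nonneg levelMeas_nonneg _))).1 holder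

theorem excess_one_add_le (hu : Integrable u m) {a b : ℝ} (hab : a ≤ b) :
    excess m u 1 b + (b - a) * levelMeas m u b ≤ excess m u 1 a := by
  have hs := nullMeasurableSet_level hu.1 b
  have hi : Integrable ({x | b < |u x|}.indicator (fun _ => b - a)) m :=
    (integrable_const _).indicator₀ hs
  have hlevel : ∫ x, {x | b < |u x|}.indicator (fun _ => b - a) x ∂m
      = (b - a) * levelMeas m u b := by
    rw [integral_indicator₀ hs, setIntegral_const, smul_eq_mul, mul_comm, levelMeas]
  rw [excess_one, excess_one, ← hlevel, ← integral_add (integrable_max_sub hu b) hi]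
  refine integral_mono ((integrable_max_sub hu b).add hi) (integrable_max_sub hu a) fun x => ?_
  by_cases h : b < |u x|
  · rw [Set.indicator_of_mem (by exact h), max_eq_left (by linarith), max_eq_left (by linarith)]
    linarith
  · rw [Set.indicator_of_notMem (by exact h), max_eq_right (by linarith), zero_add]
    exact le_max_right _ _

theorem ae_abs_le_of_excess_one_eq_zero (hu : Integrable u m) (h : excess m u 1 k = 0) :
    ∀ᵐ x ∂m, |u x| ≤ k := by
  rw [excess_one] at h
  filter_upwards [(integral_eq_zero_iff_of_nonneg (fun _ => le_max_right _ _)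
    (integrable_max_sub hu k)).1 h] with x hx
  exact sub_nonpos.1 ((le_max_left _ _).trans hx.le)

theorem rpow_mul_max_sub_le {h t : ℝ} (hr : 1 ≤ r) (hh : 0 ≤ h) :
    h ^ (r - 1) * max (t - h) 0 ≤ max t 0 ^ r := by
  rcases le_or_gt t h with hth | hth
  · rw [max_eq_right (by linarith), mul_zero]
    exact Real.rpow_nonneg (le_max_right _ _) _
  · have ht : 0 < t := by linarith
    rw [max_eq_left (by linarith), max_eq_left ht.le]
    calc h ^ (r - 1) * (t - h) ≤ t ^ (r - 1) * t := by gcongr; linarith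
      _ = t ^ r := by rw [Real.rpow_sub_one ht.ne', div_mul_cancel₀ _ ht.ne']

theorem rpow_mul_excess_one_le {h : ℝ} (hr : 1 ≤ r) (hu : MemLp u (ENNReal.ofReal r) m)
    (hh : 0 ≤ h) : h ^ (r - 1) * excess m u 1 (k + h) ≤ excess m u r k := by
  rw [excess_one, excess, ← integral_const_mul]
  refine integral_mono ((integrable_max_sub (hu.integrable (by simpa using hr)) _).const_mul _)
    (integrable_max_sub_rpow (by linarith) hu k) fun x => ?_
  simpa only [sub_sub] using rpow_mul_max_sub_le (t := |u x| - k) hr hh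

theorem tendsto_excess_atTop (hr : 0 < r) (hu : MemLp u (ENNReal.ofReal r) m) :
    Tendsto (excess m u r) atTop (𝓝 0) := by
  rw [← integral_zero α ℝ (μ := m)]
  refine tendsto_integral_filter_of_dominated_convergence _
    (Eventually.of_forall fun k => (integrable_max_sub_rpow hr hu k).1) ?_
    (integrable_max_sub_rpow hr hu 0) (ae_of_all _ fun x => ?_)
  · filter_upwards [eventually_ge_atTop 0] with k hk
    refine ae_of_all _ fun x => ?_
    rw [Real.norm_of_nonneg (by positivity)]
    gcongr
  · refine tendsto_const_nhds.congr' ?_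
    filter_upwards [eventually_ge_atTop |u x|] with k hk
    rw [max_eq_right (sub_nonpos.2 hk), Real.zero_rpow hr.ne']

theorem tendsto_rpow_mul_excess_one_atTop (hr : 1 ≤ r) (hu : MemLp u (ENNReal.ofReal r) m) :
    Tendsto (fun k => k ^ (r - 1) * excess m u 1 k) atTop (𝓝 0) := by
  have hhalf : Tendsto (fun k : ℝ => k / 2) atTop atTop :=
    tendsto_id.atTop_div_const two_pos
  have hbound : Tendsto (fun k => 2 ^ (r - 1) * excess m u r (k / 2)) atTop (𝓝 0) := by
    simpa using ((tendsto_excess_atTop (by linarith) hu).comp hhalf).const_mul (2 ^ (r - 1))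
  refine tendsto_of_tendsto_of_tendsto_of_le_of_le' tendsto_const_nhds hbound ?_ ?_
  · filter_upwards [eventually_ge_atTop 0] with k hk
    exact mul_nonneg (Real.rpow_nonneg hk _) excess_nonneg
  · filter_upwards [eventually_ge_atTop 0] with k hk
    calc k ^ (r - 1) * excess m u 1 k
        = 2 ^ (r - 1) * ((k / 2) ^ (r - 1) * excess m u 1 (k / 2 + k / 2)) := by
          rw [← mul_assoc, ← Real.mul_rpow zero_le_two (by positivity), add_halves,
            mul_div_cancel₀ _ two_ne_zero]
      _ ≤ 2 ^ (r - 1) * excess m u r (k / 2) := by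
          gcongr
          exact rpow_mul_excess_one_le hr hu (by positivity)

theorem ae_abs_le_of_excess_rpow_le (hu : Integrable u m) {a D B : ℝ} (ha : 0 ≤ a) (haD : a < D)
    (hB : 0 ≤ B)
    (h : ∀ h, k ≤ h → 0 < excess m u 1 h → excess m u 1 h ^ a ≤ B * levelMeas m u h ^ D) :
    ∀ᵐ x ∂m, |u x| ≤
      k + B ^ (1 / D) * (excess m u 1 k ^ (1 - a / D) / (2 ^ (1 - a / D) - 1)) := by
  have hD : 0 < D := ha.trans_lt haD
  have hβ : 0 < 1 - a / D := sub_pos.2 ((div_lt_one hD).2 haD)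
  have hβ' : 1 - a / D ≤ 1 := sub_le_self _ (by positivity)
  refine ae_abs_le_of_excess_one_eq_zero hu (eq_zero_of_le_rpow_mul_decrease (k := k)
    (A := levelMeas m u) (K₁ := B ^ (1 / D)) (K₂ := 0) (fun _ => excess_nonneg)
    (fun _ _ => excess_one_add_le hu) (fun _ => levelMeas_nonneg) hβ hβ' one_pos le_rfl
    (by positivity) le_rfl (fun l hl hpos => ?_) (by rw [zero_mul, add_zero]))
  rw [zero_mul, add_zero]
  exact le_rpow_mul_of_rpow_le hpos levelMeas_nonneg hB hD (h l hl.1 hpos)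

theorem le_rpow_add_rpow_mul_of_rpow_le {x y t p D Q : ℝ} (hx : 0 < x) (hy : 0 ≤ y) (ht : 0 ≤ t)
    (hQ : 0 ≤ Q) (hD : 0 < D) (h : x ^ p ≤ Q * (y + t * x) * y ^ D) :
    x ≤ ((2 * Q) ^ (1 / (D + 1)) * x ^ (1 - p / (D + 1))
      + (2 * Q * t) ^ (1 / D) * x ^ (1 - (p - 1) / D)) * y := by
  rw [add_mul]
  rcases le_total (t * x) y with hle | hle
  · refine le_add_of_le_of_nonneg (le_rpow_mul_of_rpow_le hx hy (by positivity) (by linarith) ?_)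
      (by positivity)
    calc x ^ p ≤ Q * (y + y) * y ^ D := h.trans (by gcongr)
      _ = 2 * Q * y ^ (D + 1) := by
        rw [Real.rpow_add_one' hy (by linarith)]
        ring
  · refine le_add_of_nonneg_of_le (by positivity)
      (le_rpow_mul_of_rpow_le hx hy (by positivity) hD ?_)
    rw [Real.rpow_sub_one hx.ne', div_le_iff₀ hx]
    calc x ^ p ≤ Q * (t * x + t * x) * y ^ D := h.trans (by gcongr)
      _ = 2 * Q * t * y ^ D * x := by ring

theorem eventually_excess_rpow_add_le {β β' K K' : ℝ} (hr : 1 ≤ r)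
    (hu : MemLp u (ENNReal.ofReal r) m) (hβ : 0 < β) (hβ' : 0 < β') :
    ∀ᶠ k in atTop, K * excess m u 1 k ^ β
      + K' * k ^ (1 + (r - 1) * β') * excess m u 1 k ^ β' ≤ k := by
  have hu1 : MemLp u (ENNReal.ofReal 1) m := hu.mono_exponent (by simpa using hr)
  have hlim : Tendsto (fun k => K * excess m u 1 k ^ β) atTop (𝓝 0) := by
    simpa [Real.zero_rpow hβ.ne'] using
      ((tendsto_excess_atTop one_pos hu1).rpow_const (.inr hβ.le)).const_mul K
  have hlim' : Tendsto (fun k => K' * (k ^ (r - 1) * excess m u 1 k) ^ β') atTop (𝓝 0) := by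
    simpa [Real.zero_rpow hβ'.ne'] using
      ((tendsto_rpow_mul_excess_one_atTop hr hu).rpow_const (.inr hβ'.le)).const_mul K'
  filter_upwards [hlim.eventually_le_const one_half_pos, hlim'.eventually_le_const one_half_pos,
    eventually_ge_atTop 1] with k hk hk' h1
  have hk0 : 0 < k := by linarith
  have hsplit : K' * k ^ (1 + (r - 1) * β') * excess m u 1 k ^ β'
      = K' * (k ^ (r - 1) * excess m u 1 k) ^ β' * k := by
    rw [Real.rpow_add hk0, Real.rpow_one, Real.rpow_mul hk0.le,
      Real.mul_rpow (by positivity) excess_nonneg]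
    ring
  rw [hsplit]
  nlinarith

theorem eventually_critical_level_le {β β' D K K' : ℝ} (hr : 1 ≤ r)
    (hu : MemLp u (ENNReal.ofReal r) m) (hβ : 0 < β) (hβ' : 0 < β') (hK' : 0 ≤ K')
    (hD : (r - 1) * (1 / D) = 1 + (r - 1) * β') :
    ∀ᶠ k in atTop, k + (K * (excess m u 1 k ^ β / (2 ^ β - 1))
      + (K' * (2 * k) ^ (r - 1)) ^ (1 / D) * (excess m u 1 k ^ β' / (2 ^ β' - 1))) ≤ 2 * k := by
  filter_upwards [eventually_excess_rpow_add_le hr hu hβ hβ' (K := K / (2 ^ β - 1))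
    (K' := (K' * 2 ^ (r - 1)) ^ (1 / D) / (2 ^ β' - 1)), eventually_ge_atTop 0] with k hk h0
  have hpow : (K' * (2 * k) ^ (r - 1)) ^ (1 / D)
      = (K' * 2 ^ (r - 1)) ^ (1 / D) * k ^ (1 + (r - 1) * β') := by
    rw [Real.mul_rpow zero_le_two h0, ← mul_assoc, Real.mul_rpow (by positivity) (by positivity),
      ← Real.rpow_mul h0, hD]
  rw [hpow]
  linear_combination hk

theorem excess_one_rpow_le {p X : ℝ} (hp : 0 ≤ p) (hr : 1 ≤ r) (hu : MemLp u (ENNReal.ofReal r) m)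
    (h : excess m u r k ^ (p / r) ≤ X) :
    excess m u 1 k ^ p ≤ X * levelMeas m u k ^ (p * (1 - 1 / r)) :=
  calc excess m u 1 k ^ p
      ≤ (excess m u r k ^ (1 / r) * levelMeas m u k ^ (1 - 1 / r)) ^ p :=
        Real.rpow_le_rpow excess_nonneg (excess_one_le hr hu k) hp
    _ = excess m u r k ^ (p / r) * levelMeas m u k ^ (p * (1 - 1 / r)) := by
        rw [Real.mul_rpow (Real.rpow_nonneg excess_nonneg _) (Real.rpow_nonneg levelMeas_nonneg _),
          ← Real.rpow_mul excess_nonneg, ← Real.rpow_mul levelMeas_nonneg, one_div_mul_eq_div,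
          mul_comm p]
    _ ≤ X * levelMeas m u k ^ (p * (1 - 1 / r)) := by
        gcongr
        exact Real.rpow_nonneg levelMeas_nonneg _

-- The weight `k ^ (r - 1)` is critical: it is only because `k ^ (r - 1) * excess m u 1 k → 0` that
-- the extinction level is at most `2 k` for large `k`.
theorem memLp_top_of_eventually_excess_le {p Q : ℝ} (hp : 1 ≤ p) (hpr : p < r)
    (hu : MemLp u (ENNReal.ofReal r) m) (hQ : 0 ≤ Q)
    (h : ∀ᶠ k in atTop, excess m u r k ^ (p / r)
      ≤ Q * (levelMeas m u k + k ^ (r - 1) * excess m u 1 k)) : MemLp u ⊤ m := by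
  have hr : 1 ≤ r := by linarith
  have hr0 : 0 < r := by linarith
  set D := p * (1 - 1 / r) with hDdef
  have hDr : D * r = p * (r - 1) := by rw [hDdef]; field_simp
  have hD : 0 < D := by
    rw [hDdef]
    exact mul_pos (by linarith) (sub_pos.2 ((div_lt_one hr0).2 (by linarith)))
  have hpD : p < D + 1 := by nlinarith
  set β := 1 - p / (D + 1)
  set β' := 1 - (p - 1) / D with hβ'
  have hβ0 : 0 < β := sub_pos.2 ((div_lt_one (by linarith)).2 hpD)
  have hβ1 : β ≤ 1 := sub_le_self _ (by positivity)
  have hβ'0 : 0 < β' := sub_pos.2 ((div_lt_one hD).2 (by linarith))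
  have hβ'1 : β' ≤ 1 := sub_le_self _ (div_nonneg (by linarith) hD.le)
  have hweight : (r - 1) * (1 / D) = 1 + (r - 1) * β' := by
    rw [hβ']
    field_simp
    linarith
  obtain ⟨k, hL, hk, h0⟩ := ((eventually_critical_level_le hr hu hβ0 hβ'0 (D := D)
    (K := (2 * Q) ^ (1 / (D + 1))) (K' := 2 * Q) (by positivity) hweight).and
      ((eventually_forall_ge_atTop.2 h).and (eventually_ge_atTop 0))).exists
  have hui : Integrable u m := hu.integrable (by simpa using hr)
  refine memLp_top_of_bound hu.1 (2 * k) (ae_abs_le_of_excess_one_eq_zero hui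
    (eq_zero_of_le_rpow_mul_decrease (k := k) (A := levelMeas m u)
      (K₁ := (2 * Q) ^ (1 / (D + 1))) (K₂ := (2 * Q * (2 * k) ^ (r - 1)) ^ (1 / D))
      (fun _ => excess_nonneg) (fun _ _ => excess_one_add_le hui) (fun _ => levelMeas_nonneg)
      hβ0 hβ1 hβ'0 hβ'1 (by positivity) (by positivity) (fun l hl hpos => ?_) hL))
  refine le_rpow_add_rpow_mul_of_rpow_le hpos levelMeas_nonneg (by positivity) hQ hD
    (excess_one_rpow_le (by linarith) hr hu ((hk l hl.1).trans ?_))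
  have hl0 : 0 ≤ l := h0.trans hl.1
  have hl2 : l ≤ 2 * k := hl.2
  gcongr

end Excess

section DominatedConvergence

variable {α E : Type*} [MeasurableSpace α] [NormedAddCommGroup E] {m : Measure α}

theorem tendsto_eLpNorm_sub_trans {q : ENNReal} (hq : 1 ≤ q) {a b : ℕ → α → E} {c : α → E}
    (ha : ∀ n, AEStronglyMeasurable (a n) m) (hb : ∀ n, AEStronglyMeasurable (b n) m)
    (hc : AEStronglyMeasurable c m)
    (hab : Tendsto (fun n => eLpNorm (fun x => a n x - b n x) q m) atTop (𝓝 0))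
    (hbc : Tendsto (fun n => eLpNorm (fun x => b n x - c x) q m) atTop (𝓝 0)) :
    Tendsto (fun n => eLpNorm (fun x => a n x - c x) q m) atTop (𝓝 0) := by
  refine tendsto_of_tendsto_of_tendsto_of_le_of_le tendsto_const_nhds
    (by simpa using hab.add hbc) (fun _ => zero_le) fun n => ?_
  have := eLpNorm_add_le ((ha n).sub (hb n)) ((hb n).sub hc) hq
  rw [sub_add_sub_cancel] at this
  exact this

variable {p : ℝ} {F : ℕ → α → E} {f : α → E} {g : α → ℝ}

theorem memLp_of_tendsto_of_dominated {q : ENNReal} (hF : ∀ n, AEStronglyMeasurable (F n) m)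
    (hg : MemLp g q m) (hbound : ∀ n, ∀ᵐ x ∂m, ‖F n x‖ ≤ g x)
    (hlim : ∀ᵐ x ∂m, Tendsto (fun n => F n x) atTop (𝓝 (f x))) : MemLp f q m := by
  refine hg.mono' (aestronglyMeasurable_of_tendsto_ae atTop hF hlim) ?_
  filter_upwards [ae_all_iff.2 hbound, hlim] with x hx hlimx
  exact le_of_tendsto' hlimx.norm hx

theorem tendsto_eLpNorm_sub_of_dominated (hp : 0 < p) (hF : ∀ n, AEStronglyMeasurable (F n) m)
    (hg : MemLp g (ENNReal.ofReal p) m) (hbound : ∀ n, ∀ᵐ x ∂m, ‖F n x‖ ≤ g x)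
    (hlim : ∀ᵐ x ∂m, Tendsto (fun n => F n x) atTop (𝓝 (f x))) :
    Tendsto (fun n => eLpNorm (fun x => F n x - f x) (ENNReal.ofReal p) m) atTop (𝓝 0) := by
  have hf : MemLp f (ENNReal.ofReal p) m := memLp_of_tendsto_of_dominated hF hg hbound hlim
  have h0 : ENNReal.ofReal p ≠ 0 := by simpa using hp
  have hpt : (ENNReal.ofReal p).toReal = p := ENNReal.toReal_ofReal hp.le
  have hdom : MemLp (fun x => g x + ‖f x‖) (ENNReal.ofReal p) m := hg.add hf.norm
  have hfin : ∫⁻ x, ‖g x + ‖f x‖‖ₑ ^ p ∂m ≠ ⊤ := by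
    have := (lintegral_rpow_enorm_lt_top_of_eLpNorm_lt_top h0 ENNReal.ofReal_ne_top hdom.2).ne
    rwa [hpt] at this
  have hpow : Tendsto (fun n => ∫⁻ x, ‖F n x - f x‖ₑ ^ p ∂m) atTop (𝓝 0) := by
    rw [← lintegral_zero (μ := m)]
    refine tendsto_lintegral_of_dominated_convergence' _
      (fun n => ((hF n).sub hf.1).enorm.pow_const p) (fun n => ?_) hfin ?_
    · filter_upwards [hbound n] with x hx
      have : ‖F n x - f x‖ ≤ ‖g x + ‖f x‖‖ :=
        (norm_sub_le _ _).trans ((add_le_add_left hx _).trans (le_abs_self _))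
      have := enorm_le_iff_norm_le.2 this
      gcongr
    · filter_upwards [hlim] with x hx
      simpa [ENNReal.zero_rpow_of_pos hp] using (hx.sub_const (f x)).enorm.ennrpow_const p
  simpa [eLpNorm_eq_lintegral_rpow_enorm_toReal h0 ENNReal.ofReal_ne_top, hpt,
    ENNReal.zero_rpow_of_pos (inv_pos.2 hp)] using hpow.ennrpow_const p⁻¹

end DominatedConvergence

section Gradient

variable {E : Type*} [NormedAddCommGroup E] [InnerProductSpace ℝ E] [CompleteSpace E] {φ : E → ℝ}

theorem norm_gradient_eq (φ : E → ℝ) (x : E) : ‖gradient φ x‖ = ‖fderiv ℝ φ x‖ := by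
  simp [gradient]

theorem continuous_gradient (hφ : ContDiff ℝ ∞ φ) : Continuous (gradient φ) :=
  (LinearIsometryEquiv.continuous _).comp (hφ.continuous_fderiv (by simp))

theorem gradient_comp {η : ℝ → ℝ} (hη : Differentiable ℝ η) (hφ : Differentiable ℝ φ) (x : E) :
    gradient (fun y => η (φ y)) x = deriv η (φ x) • gradient φ x := by
  have h : HasFDerivAt (fun y => η (φ y)) (deriv η (φ x) • fderiv ℝ φ x) x :=
    (hη (φ x)).hasDerivAt.comp_hasFDerivAt x (hφ x).hasFDerivAt
  simp [gradient, h.fderiv]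

end Gradient

theorem norm_smul_le_of_abs_le_one {E : Type*} [NormedAddCommGroup E] [NormedSpace ℝ E] {a : ℝ}
    (ha : |a| ≤ 1) (z : E) : ‖a • z‖ ≤ ‖z‖ := by
  rw [norm_smul]
  exact mul_le_of_le_one_left (norm_nonneg _) ha

theorem abs_sub_le_of_abs_deriv_le_one {η : ℝ → ℝ} (hη : Differentiable ℝ η)
    (hη' : ∀ t, |deriv η t| ≤ 1) (s t : ℝ) : |η s - η t| ≤ |s - t| := by
  simpa using Convex.norm_image_sub_le_of_norm_deriv_le (C := 1) (fun x _ => hη x)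
    (fun x _ => hη' x) convex_univ (Set.mem_univ t) (Set.mem_univ s)

/-- The elements `φ` of `C_c^∞(Ω)`. -/
abbrev IsTestFunction {N : ℕ} (Ω : Set (RN N)) (φ : RN N → ℝ) : Prop :=
  ContDiff ℝ ∞ φ ∧ HasCompactSupport φ ∧ tsupport φ ⊆ Ω

namespace MemW0

variable {N : ℕ} {Ω : Set (RN N)} {p : ℝ} {u : RN N → ℝ} {Du : RN N → RN N}

theorem exists_approx (h : MemW0 Ω p u Du) {ε : ENNReal} (hε : 0 < ε) :
    ∃ φ : RN N → ℝ, IsTestFunction Ω φ ∧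
      eLpNorm (fun x => φ x - u x) (ENNReal.ofReal p) (volume.restrict Ω) ≤ ε ∧
      eLpNorm (fun x => gradient φ x - Du x) (ENNReal.ofReal p) (volume.restrict Ω) ≤ ε := by
  obtain ⟨φ, hφ, hlim, hlimD⟩ := h.approx
  obtain ⟨n, hn, hnD⟩ :=
    ((hlim.eventually_le_const hε).and (hlimD.eventually_le_const hε)).exists
  exact ⟨φ n, hφ n, hn, hnD⟩

theorem exists_approx_ae (hp : 0 < p) (h : MemW0 Ω p u Du) : ∃ φ : ℕ → RN N → ℝ,
    (∀ n, IsTestFunction Ω (φ n)) ∧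
    Tendsto (fun n => eLpNorm (fun x => φ n x - u x) (ENNReal.ofReal p) (volume.restrict Ω))
      atTop (𝓝 0) ∧
    Tendsto (fun n => eLpNorm (fun x => gradient (φ n) x - Du x) (ENNReal.ofReal p)
      (volume.restrict Ω)) atTop (𝓝 0) ∧
    ∀ᵐ x ∂(volume.restrict Ω), Tendsto (fun n => φ n x) atTop (𝓝 (u x)) := by
  obtain ⟨φ, hφ, hlim, hlimD⟩ := h.approx
  obtain ⟨ns, hns, hae⟩ := (tendstoInMeasure_of_tendsto_eLpNorm (by simpa using hp)
    (fun n => (hφ n).1.continuous.aestronglyMeasurable) h.memLp.1 hlim).exists_seq_tendsto_ae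
  exact ⟨fun n => φ (ns n), fun n => hφ _, hlim.comp hns.tendsto_atTop,
    hlimD.comp hns.tendsto_atTop, hae⟩

theorem of_tendsto (hp : 1 ≤ p) {w : ℕ → RN N → ℝ} {Dw : ℕ → RN N → RN N}
    (hw : ∀ n, MemW0 Ω p (w n) (Dw n)) (hu : MemLp u (ENNReal.ofReal p) (volume.restrict Ω))
    (hDu : MemLp Du (ENNReal.ofReal p) (volume.restrict Ω))
    (hlim : Tendsto (fun n => eLpNorm (fun x => w n x - u x) (ENNReal.ofReal p)
      (volume.restrict Ω)) atTop (𝓝 0))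
    (hDlim : Tendsto (fun n => eLpNorm (fun x => Dw n x - Du x) (ENNReal.ofReal p)
      (volume.restrict Ω)) atTop (𝓝 0)) : MemW0 Ω p u Du := by
  have hp1 : 1 ≤ ENNReal.ofReal p := by simpa using hp
  have hε : Tendsto (fun n : ℕ => ((n : ENNReal) + 1)⁻¹) atTop (𝓝 0) := by
    simpa [Function.comp_def] using
      ENNReal.tendsto_inv_nat_nhds_zero.comp (tendsto_add_atTop_nat 1)
  choose φ hφ hφw hφDw using fun n =>
    (hw n).exists_approx (ε := ((n : ENNReal) + 1)⁻¹) (by simp)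
  have hφm : ∀ n, AEStronglyMeasurable (φ n) (volume.restrict Ω) := fun n =>
    (hφ n).1.continuous.aestronglyMeasurable
  have hφDm : ∀ n, AEStronglyMeasurable (gradient (φ n)) (volume.restrict Ω) := fun n =>
    (continuous_gradient (hφ n).1).aestronglyMeasurable
  exact ⟨hu, hDu, φ, hφ,
    tendsto_eLpNorm_sub_trans hp1 hφm (fun n => (hw n).memLp.1) hu.1
      (tendsto_of_tendsto_of_tendsto_of_le_of_le tendsto_const_nhds hε (fun _ => zero_le) hφw) hlim,
    tendsto_eLpNorm_sub_trans hp1 hφDm (fun n => (hw n).memLp_grad.1) hDu.1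
      (tendsto_of_tendsto_of_tendsto_of_le_of_le tendsto_const_nhds hε (fun _ => zero_le) hφDw)
      hDlim⟩

theorem comp_smooth (hp : 1 ≤ p) (h : MemW0 Ω p u Du) {η : ℝ → ℝ} (hη : ContDiff ℝ ∞ η)
    (hη0 : η 0 = 0) (hη1 : ∀ t, |deriv η t| ≤ 1) :
    MemW0 Ω p (fun x => η (u x)) (fun x => deriv η (u x) • Du x) := by
  have hp0 : 0 < p := by linarith
  have hd : Differentiable ℝ η := hη.differentiable (by simp)
  have hc : Continuous (deriv η) := hη.continuous_deriv (by simp)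
  have hlip : ∀ s t, ‖η s - η t‖ ≤ ‖s - t‖ := abs_sub_le_of_abs_deriv_le_one hd hη1
  have hle : ∀ t (z : RN N), ‖deriv η t • z‖ ≤ ‖z‖ := fun t => norm_smul_le_of_abs_le_one (hη1 t)
  obtain ⟨φ, hφ, hlim, hlimD, hae⟩ := h.exists_approx_ae hp0
  have hφm : ∀ n, AEStronglyMeasurable (fun x => deriv η (φ n x)) (volume.restrict Ω) := fun n =>
    (hc.comp (hφ n).1.continuous).aestronglyMeasurable
  have hgrad : ∀ n, gradient (fun x => η (φ n x)) = fun x => deriv η (φ n x) • gradient (φ n) x :=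
    fun n => funext (gradient_comp hd ((hφ n).1.differentiable (by simp)))
  have hDu : AEStronglyMeasurable (fun x => deriv η (u x) • Du x) (volume.restrict Ω) :=
    (hc.comp_aestronglyMeasurable h.memLp.1).smul h.memLp_grad.1
  refine ⟨h.memLp.mono (hη.continuous.comp_aestronglyMeasurable h.memLp.1)
      (ae_of_all _ fun x => by simpa [hη0] using hlip (u x) 0),
    h.memLp_grad.mono hDu (ae_of_all _ fun x => hle _ _), fun n x => η (φ n x),
    fun n => ⟨hη.comp (hφ n).1, (hφ n).2.1.comp_left hη0,
      (tsupport_comp_subset hη0 (φ n)).trans (hφ n).2.2⟩,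
    tendsto_of_tendsto_of_tendsto_of_le_of_le tendsto_const_nhds hlim (fun _ => zero_le)
      fun n => eLpNorm_mono fun x => hlip _ _, ?_⟩
  simp only [hgrad]
  refine tendsto_eLpNorm_sub_trans (b := fun n x => deriv η (φ n x) • Du x) (by simpa using hp)
    (fun n => (hφm n).smul (continuous_gradient (hφ n).1).aestronglyMeasurable)
    (fun n => (hφm n).smul h.memLp_grad.1) hDu ?_ ?_
  · refine tendsto_of_tendsto_of_tendsto_of_le_of_le tendsto_const_nhds hlimD (fun _ => zero_le)
      fun n => eLpNorm_mono fun x => ?_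
    rw [← smul_sub]
    exact hle _ _
  · refine tendsto_eLpNorm_sub_of_dominated hp0 (fun n => (hφm n).smul h.memLp_grad.1)
      h.memLp_grad.norm (fun n => ae_of_all _ fun x => hle _ _) ?_
    filter_upwards [hae] with x hx
    exact ((hc.tendsto _).comp hx).smul_const _

theorem comp_of_tendsto (hp : 1 ≤ p) (h : MemW0 Ω p u Du) {η : ℕ → ℝ → ℝ} {ζ d : ℝ → ℝ}
    (hη : ∀ n, ContDiff ℝ ∞ (η n)) (hη0 : ∀ n, η n 0 = 0) (hη1 : ∀ n t, |deriv (η n) t| ≤ 1)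
    (hζ : ∀ t, Tendsto (fun n => η n t) atTop (𝓝 (ζ t)))
    (hd : ∀ t, Tendsto (fun n => deriv (η n) t) atTop (𝓝 (d t))) :
    MemW0 Ω p (fun x => ζ (u x)) (fun x => d (u x) • Du x) := by
  have hp0 : 0 < p := by linarith
  have hmem n := h.comp_smooth hp (hη n) (hη0 n) (hη1 n)
  have hm n := (hmem n).memLp.1
  have hmD n := (hmem n).memLp_grad.1
  have hbound : ∀ n, ∀ᵐ x ∂volume.restrict Ω, ‖η n (u x)‖ ≤ ‖u x‖ := fun n =>
    ae_of_all _ fun x => by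
      simpa [hη0] using
        abs_sub_le_of_abs_deriv_le_one ((hη n).differentiable (by simp)) (hη1 n) (u x) 0
  have hboundD : ∀ n, ∀ᵐ x ∂volume.restrict Ω, ‖deriv (η n) (u x) • Du x‖ ≤ ‖Du x‖ := fun n =>
    ae_of_all _ fun x => norm_smul_le_of_abs_le_one (hη1 n _) _
  have hlim : ∀ᵐ x ∂volume.restrict Ω, Tendsto (fun n => η n (u x)) atTop (𝓝 (ζ (u x))) :=
    ae_of_all _ fun x => hζ (u x)
  have hlimD : ∀ᵐ x ∂volume.restrict Ω,
      Tendsto (fun n => deriv (η n) (u x) • Du x) atTop (𝓝 (d (u x) • Du x)) :=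
    ae_of_all _ fun x => (hd (u x)).smul_const _
  exact of_tendsto hp hmem (memLp_of_tendsto_of_dominated hm h.memLp.norm hbound hlim)
    (memLp_of_tendsto_of_dominated hmD h.memLp_grad.norm hboundD hlimD)
    (tendsto_eLpNorm_sub_of_dominated hp0 hm h.memLp.norm hbound hlim)
    (tendsto_eLpNorm_sub_of_dominated hp0 hmD h.memLp_grad.norm hboundD hlimD)

end MemW0

section Truncation

/-- The truncation of the real number `t` at the levels `± k`. -/
noncomputable def trunc (k t : ℝ) : ℝ := max (-k) (min t k)

variable {k t : ℝ}

theorem trunc_of_abs_le (h : |t| ≤ k) : trunc k t = t := by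
  rw [abs_le] at h
  rw [trunc, min_eq_left h.2, max_eq_right h.1]

theorem continuous_trunc (k : ℝ) : Continuous (trunc k) := by
  unfold trunc
  fun_prop

theorem abs_trunc_le_abs (hk : 0 ≤ k) : |trunc k t| ≤ |t| := by
  rcases le_or_gt |t| k with h | h
  · rw [trunc_of_abs_le h]
  · exact (abs_le.2 ⟨le_max_left _ _, max_le (by linarith) (min_le_right _ _)⟩).trans h.le

theorem sub_trunc (hk : 0 ≤ k) : t - trunc k t = Real.sign t * max (|t| - k) 0 := by
  rcases le_or_gt |t| k with h | h
  · rw [trunc_of_abs_le h, max_eq_right (by linarith)]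
    simp
  rw [max_eq_left (by linarith)]
  rcases lt_abs.1 h with h | h
  · rw [Real.sign_of_pos (by linarith), abs_of_pos (by linarith), trunc, min_eq_right h.le,
      max_eq_right (by linarith), one_mul]
  · rw [Real.sign_of_neg (by linarith), abs_of_neg (by linarith), trunc,
      min_eq_left (by linarith), max_eq_left (by linarith)]
    ring

theorem abs_sub_trunc (hk : 0 ≤ k) : |t - trunc k t| = max (|t| - k) 0 := by
  rw [sub_trunc hk, abs_mul, abs_of_nonneg (le_max_right (|t| - k) 0)]
  rcases le_or_gt |t| k with h | h
  · rw [max_eq_right (by linarith), mul_zero]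
  · have : t ≠ 0 := abs_pos.1 (hk.trans_lt h)
    rcases Real.sign_apply_eq_of_ne_zero t this with h | h <;> simp [h]

/-- A smooth bump function equal to `1` on `[-k, k]` and vanishing outside of
`[-k - 1 / (n + 1), k + 1 / (n + 1)]`. -/
noncomputable def levelBump (k : ℝ) (hk : 0 < k) (n : ℕ) : ContDiffBump (0 : ℝ) where
  rIn := k
  rOut := k + 1 / (n + 1)
  rIn_pos := hk
  rIn_lt_rOut := lt_add_of_pos_right k (by positivity)

/-- The smooth approximation of `trunc k` with derivative `levelBump k hk n`. -/
noncomputable def smoothTrunc (k : ℝ) (hk : 0 < k) (n : ℕ) (t : ℝ) : ℝ :=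
  ∫ s in (0 : ℝ)..t, levelBump k hk n s

theorem levelBump_mem_Icc (hk : 0 < k) (n : ℕ) (t : ℝ) : levelBump k hk n t ∈ Set.Icc 0 1 :=
  ⟨ContDiffBump.nonneg _, ContDiffBump.le_one _⟩

theorem tendsto_levelBump (hk : 0 < k) (t : ℝ) :
    Tendsto (fun n => levelBump k hk n t) atTop (𝓝 ((Set.Icc (-k) k).indicator 1 t)) := by
  refine tendsto_const_nhds.congr' ?_
  by_cases ht : |t| ≤ k
  · have hmem : t ∈ Set.Icc (-k) k := abs_le.1 ht
    rw [Set.indicator_of_mem hmem]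
    exact Eventually.of_forall fun n => ((levelBump k hk n).one_of_mem_closedBall
      (by simpa [levelBump] using ht)).symm
  · have hmem : t ∉ Set.Icc (-k) k := fun h => ht (abs_le.2 h)
    rw [Set.indicator_of_notMem hmem]
    filter_upwards [tendsto_one_div_add_atTop_nhds_zero_nat.eventually_lt_const
      (sub_pos.2 (not_le.1 ht))] with n hn
    refine ((levelBump k hk n).zero_of_le_dist ?_).symm
    simp only [levelBump, dist_zero_right, Real.norm_eq_abs]
    linarith

theorem deriv_smoothTrunc (hk : 0 < k) (n : ℕ) : deriv (smoothTrunc k hk n) = levelBump k hk n :=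
  funext fun t => (levelBump k hk n).continuous.deriv_integral _ 0 t

theorem contDiff_smoothTrunc (hk : 0 < k) (n : ℕ) : ContDiff ℝ ∞ (smoothTrunc k hk n) :=
  contDiff_infty_iff_deriv.2 ⟨fun t => ((levelBump k hk n).continuous.integral_hasStrictDerivAt
    0 t).hasDerivAt.differentiableAt, deriv_smoothTrunc hk n ▸ (levelBump k hk n).contDiff⟩

theorem smoothTrunc_zero (hk : 0 < k) (n : ℕ) : smoothTrunc k hk n 0 = 0 :=
  intervalIntegral.integral_same

theorem integral_indicator_Icc_eq_trunc (hk : 0 ≤ k) (t : ℝ) :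
    ∫ s in (0 : ℝ)..t, (Set.Icc (-k) k).indicator 1 s = trunc k t := by
  have hae : (Set.Icc (-k) k).indicator (1 : ℝ → ℝ) =ᵐ[volume] (Set.Ioc (-k) k).indicator 1 :=
    indicator_ae_eq_of_ae_eq_set Ioc_ae_eq_Icc.symm
  rw [intervalIntegral.integral_congr_ae (hae.mono fun s hs _ => hs)]
  rcases le_total 0 t with ht | ht
  · rw [intervalIntegral.integral_of_le ht, setIntegral_indicator measurableSet_Ioc,
      Set.Ioc_inter_Ioc]
    simp only [Pi.one_apply, setIntegral_const, measureReal_def, Real.volume_Ioc, smul_eq_mul,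
      mul_one]
    rw [max_eq_left (by linarith), sub_zero, ENNReal.toReal_ofReal (le_min ht hk), trunc,
      max_eq_right (by linarith [le_min ht hk])]
  · rw [intervalIntegral.integral_of_ge ht, setIntegral_indicator measurableSet_Ioc,
      Set.Ioc_inter_Ioc]
    simp only [Pi.one_apply, setIntegral_const, measureReal_def, Real.volume_Ioc, smul_eq_mul,
      mul_one]
    rw [min_eq_left hk, ENNReal.toReal_ofReal (by simp [ht, hk]), trunc,
      min_eq_left (ht.trans hk), max_comm]
    ring

theorem tendsto_smoothTrunc (hk : 0 < k) (t : ℝ) :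
    Tendsto (fun n => smoothTrunc k hk n t) atTop (𝓝 (trunc k t)) := by
  rw [← integral_indicator_Icc_eq_trunc hk.le]
  refine intervalIntegral.tendsto_integral_filter_of_dominated_convergence (fun _ => 1)
    (Eventually.of_forall fun n => (levelBump k hk n).continuous.aestronglyMeasurable)
    (Eventually.of_forall fun n => ae_of_all _ fun s _ => ?_) (by simp)
    (ae_of_all _ fun s _ => tendsto_levelBump hk s)
  rw [Real.norm_of_nonneg (levelBump_mem_Icc hk n s).1]
  exact (levelBump_mem_Icc hk n s).2

theorem MemW0.comp_trunc {N : ℕ} {Ω : Set (RN N)} {p : ℝ} {u : RN N → ℝ} {Du : RN N → RN N}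
    (hp : 1 ≤ p) (h : MemW0 Ω p u Du) (hk : 0 < k) :
    MemW0 Ω p (fun x => trunc k (u x)) ({x | |u x| ≤ k}.indicator Du) := by
  convert h.comp_of_tendsto (d := (Set.Icc (-k) k).indicator 1) hp (contDiff_smoothTrunc hk)
    (smoothTrunc_zero hk) (fun n t => ?_) (tendsto_smoothTrunc hk) (fun t => ?_) using 2 with x
  · simp [Set.indicator, abs_le]
  · rw [deriv_smoothTrunc, abs_of_nonneg (levelBump_mem_Icc hk n t).1]
    exact (levelBump_mem_Icc hk n t).2
  · simp only [deriv_smoothTrunc]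
    exact tendsto_levelBump hk t

theorem MemW0.sub_comp_trunc {N : ℕ} {Ω : Set (RN N)} {p : ℝ} {u : RN N → ℝ} {Du : RN N → RN N}
    (hp : 1 ≤ p) (h : MemW0 Ω p u Du) (hk : 0 < k) :
    MemW0 Ω p (fun x => u x - trunc k (u x)) ({x | k < |u x|}.indicator Du) := by
  have hderiv : ∀ n, deriv (fun t => t - smoothTrunc k hk n t) = fun t => 1 - levelBump k hk n t :=
    fun n => funext fun t => by
      rw [deriv_fun_sub differentiableAt_fun_id
        ((contDiff_smoothTrunc hk n).differentiable (by simp) t), deriv_id'', deriv_smoothTrunc]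
  convert h.comp_of_tendsto (η := fun n t => t - smoothTrunc k hk n t)
    (d := fun t => 1 - (Set.Icc (-k) k).indicator 1 t) hp
    (fun n => contDiff_id.sub (contDiff_smoothTrunc hk n)) (fun n => by simp [smoothTrunc_zero])
    (fun n t => ?_) (fun t => (tendsto_smoothTrunc hk t).const_sub t) (fun t => ?_) using 2 with x
  · by_cases hx : |u x| ≤ k
    · simp [abs_le.1 hx, not_lt.2 hx]
    · have : ¬ (-k ≤ u x ∧ u x ≤ k) := fun h => hx (abs_le.2 h)
      simp [Set.indicator, not_le.1 hx, this]
  · have := levelBump_mem_Icc hk n t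
    rw [hderiv, abs_of_nonneg (sub_nonneg.2 this.2)]
    exact sub_le_self _ this.1
  · simp only [hderiv]
    exact (tendsto_levelBump hk t).const_sub 1

end Truncation

section FiniteMeasure

variable {α E : Type*} [MeasurableSpace α] [NormedAddCommGroup E] {m : Measure α}
  [IsFiniteMeasure m] {p q : ENNReal}

theorem exists_eLpNorm_le_mul (hpq : p ≤ q) : ∃ C : NNReal, ∀ f : α → E,
    AEStronglyMeasurable f m → eLpNorm f p m ≤ C * eLpNorm f q m := by
  rcases eq_or_ne p 0 with rfl | hp
  · exact ⟨0, by simp⟩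
  have hexp : 0 ≤ 1 / p.toReal - 1 / q.toReal := by
    rcases eq_or_ne q ⊤ with rfl | hq
    · simp
    · exact sub_nonneg.2 (one_div_le_one_div_of_le
        (ENNReal.toReal_pos hp (ne_top_of_le_ne_top hq hpq)) (ENNReal.toReal_mono hq hpq))
  lift m Set.univ ^ (1 / p.toReal - 1 / q.toReal) to NNReal using
    ENNReal.rpow_ne_top_of_nonneg hexp (measure_ne_top m _) with C hC
  exact ⟨C, fun f hf => by
    simpa [hC, mul_comm] using eLpNorm_le_eLpNorm_mul_rpow_measure_univ hpq hf⟩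

theorem tendsto_eLpNorm_zero_of_exponent_le (hpq : p ≤ q) {f : ℕ → α → E}
    (hf : ∀ n, AEStronglyMeasurable (f n) m)
    (hlim : Tendsto (fun n => eLpNorm (f n) q m) atTop (𝓝 0)) :
    Tendsto (fun n => eLpNorm (f n) p m) atTop (𝓝 0) := by
  obtain ⟨C, hC⟩ := exists_eLpNorm_le_mul (E := E) (m := m) hpq
  have := ENNReal.Tendsto.const_mul hlim (Or.inr (ENNReal.coe_ne_top (r := C)))
  rw [mul_zero] at this
  exact tendsto_of_tendsto_of_tendsto_of_le_of_le tendsto_const_nhds this (fun _ => zero_le)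
    fun n => hC _ (hf n)

end FiniteMeasure

section Sobolev

/-- The Sobolev inequality `‖φ‖_r ≤ S ‖∇φ‖_s` for all test functions `φ` on `ℝᴺ`. -/
def SobolevInequality (N : ℕ) (s r : ENNReal) (S : NNReal) : Prop :=
  ∀ φ : RN N → ℝ, ContDiff ℝ ∞ φ → HasCompactSupport φ →
    eLpNorm φ r volume ≤ S * eLpNorm (fderiv ℝ φ) s volume

theorem exists_sobolevInequality {N : ℕ} (hN : 1 ≤ N) {s r : ℝ} (hs : 1 ≤ s) (hr : 0 < r)
    (hsr : r⁻¹ = s⁻¹ - (N : ℝ)⁻¹) :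
    ∃ S, SobolevInequality N (ENNReal.ofReal s) (ENNReal.ofReal r) S := by
  have hfin : Module.finrank ℝ (RN N) = N := by simp
  refine ⟨eLpNormLESNormFDerivOfEqInnerConst (volume : Measure (RN N)) s.toNNReal,
    fun φ hφ hc => ?_⟩
  refine eLpNorm_le_eLpNorm_fderiv_of_eq_inner volume (hφ.of_le (by simp)) hc
    (p := s.toNNReal) (p' := r.toNNReal) (by simpa using hs) (by omega) ?_
  rw [Real.coe_toNNReal _ hr.le, hfin, NNReal.coe_inv, Real.coe_toNNReal _ (by linarith), hsr]

theorem enorm_le_lintegral_fderiv {φ : RN 1 → ℝ} (hφ : ContDiff ℝ 1 φ)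
    (hc : HasCompactSupport φ) (x : RN 1) : ‖φ x‖ₑ ≤ ∫⁻ y, ‖fderiv ℝ φ y‖ₑ := by
  let L : ℝ ≃ₗᵢ[ℝ] RN 1 := (OrthonormalBasis.singleton (Fin 1) ℝ).repr
  have hderiv : ∀ t, ‖deriv (φ ∘ L) t‖ ≤ ‖fderiv ℝ φ (L t)‖ := fun t => by
    have hL : HasDerivAt L (L 1) t := by
      simpa using (L.toContinuousLinearEquiv : ℝ →L[ℝ] RN 1).hasDerivAt (x := t)
    rw [((hφ.differentiable one_ne_zero (L t)).hasFDerivAt.comp_hasDerivAt t hL).deriv]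
    simpa using (fderiv ℝ φ (L t)).le_opNorm (L 1)
  calc ‖φ x‖ₑ = ‖(φ ∘ L) (L.symm x)‖ₑ := by simp
    _ ≤ ∫⁻ t in Set.Iic (L.symm x), ‖deriv (φ ∘ L) t‖ₑ :=
        (hc.comp_homeomorph L.toHomeomorph).enorm_le_lintegral_Ici_deriv
          (hφ.comp L.contDiff) (L.symm x)
    _ ≤ ∫⁻ t, ‖deriv (φ ∘ L) t‖ₑ := setLIntegral_le_lintegral _ _
    _ ≤ ∫⁻ t, ‖fderiv ℝ φ (L t)‖ₑ :=
        lintegral_mono fun t => enorm_le_iff_norm_le.2 (hderiv t)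
    _ = ∫⁻ y, ‖fderiv ℝ φ y‖ₑ :=
        L.measurePreserving.lintegral_comp_emb L.toHomeomorph.measurableEmbedding
          fun y => ‖fderiv ℝ φ y‖ₑ

theorem sobolevInequality_one_top : SobolevInequality 1 1 ⊤ 1 := fun φ hφ hc => by
  rw [ENNReal.coe_one, one_mul, eLpNorm_exponent_top, eLpNorm_one_eq_lintegral_enorm]
  exact eLpNormEssSup_le_of_ae_enorm_bound
    (ae_of_all _ (enorm_le_lintegral_fderiv (hφ.of_le (by simp)) hc))

theorem exists_sobolevInequality_one {N : ℕ} (hN : 1 ≤ N) : ∃ (r : ENNReal) (S : NNReal),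
    1 ≤ r ∧ 1 - 1 / r.toReal = 1 / N ∧ SobolevInequality N 1 r S := by
  rcases hN.eq_or_lt with rfl | hN1
  · exact ⟨⊤, 1, le_top, by simp, sobolevInequality_one_top⟩
  · have hN' : (0 : ℝ) < N - 1 := sub_pos.2 (by exact_mod_cast hN1)
    have : (0 : ℝ) < N := by linarith
    obtain ⟨S, hS⟩ := exists_sobolevInequality hN (r := N / (N - 1)) le_rfl (by positivity)
      (by field_simp)
    refine ⟨_, S, ?_, ?_, by simpa using hS⟩
    · rw [ENNReal.one_le_ofReal, one_le_div hN']
      linarith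
    · rw [ENNReal.toReal_ofReal (by positivity)]
      field_simp
      ring

theorem exists_sobolevInequality_of_le_critExp {N : ℕ} (hN : 1 ≤ N) {p q : ℝ} (hp : 1 ≤ p)
    (hpN : p ≤ N) (hq : (q : EReal) ≤ critExp N p) : ∃ (s r : ℝ) (r' : ENNReal) (S : NNReal),
    1 ≤ s ∧ s ≤ p ∧ p < r ∧ q ≤ r ∧ ENNReal.ofReal r ≤ r' ∧
      SobolevInequality N (ENNReal.ofReal s) r' S := by
  have hN0 : (0 : ℝ) < N := by exact_mod_cast hN
  rcases hpN.lt_or_eq with hlt | rfl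
  · have hd : 0 < N - p := sub_pos.2 hlt
    rw [critExp, if_pos hlt, EReal.coe_le_coe_iff] at hq
    obtain ⟨S, hS⟩ := exists_sobolevInequality hN (r := N * p / (N - p)) hp (by positivity)
      (by field_simp)
    refine ⟨p, _, _, S, hp, le_rfl, ?_, hq, le_rfl, hS⟩
    rw [lt_div_iff₀ hd]
    nlinarith
  rcases hN.eq_or_lt with rfl | hN1
  · exact ⟨1, max q 2, ⊤, 1, le_rfl, by simp, by simp, le_max_left _ _, le_top,
      by simpa using sobolevInequality_one_top⟩
  · have hN2 : (2 : ℝ) ≤ N := by exact_mod_cast hN1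
    obtain ⟨r, hqr, hNr⟩ : ∃ r : ℝ, q ≤ r ∧ N + 2 ≤ r := ⟨_, le_max_left _ _, le_max_right _ _⟩
    have hr : 0 < r := by linarith
    have hs : 1 ≤ N * r / (N + r) := by
      rw [le_div_iff₀ (by positivity)]
      nlinarith
    obtain ⟨S, hS⟩ := exists_sobolevInequality hN hs hr (by field_simp; ring)
    refine ⟨_, r, _, S, hs, ?_, by linarith, hqr, le_rfl, hS⟩
    rw [div_le_iff₀ (by positivity)]
    nlinarith

end Sobolev

/-- The integral of `|Du|^p` over `{|u| > k}`. -/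
noncomputable def levelEnergy {N : ℕ} (m : Measure (RN N)) (p : ℝ) (u : RN N → ℝ)
    (Du : RN N → RN N) (k : ℝ) : ℝ := ∫ x in {x | k < |u x|}, ‖Du x‖ ^ p ∂m

theorem levelEnergy_nonneg {N : ℕ} {m : Measure (RN N)} {p k : ℝ} {u : RN N → ℝ}
    {Du : RN N → RN N} : 0 ≤ levelEnergy m p u Du k :=
  integral_nonneg fun _ => by positivity

namespace MemW0

variable {N : ℕ} {Ω : Set (RN N)} {p k : ℝ} {u : RN N → ℝ} {Du : RN N → RN N}

theorem integrable [IsFiniteMeasure (volume.restrict Ω)] (hp : 1 ≤ p) (h : MemW0 Ω p u Du) :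
    Integrable u (volume.restrict Ω) :=
  h.memLp.integrable (by simpa using hp)

theorem mono_exponent [IsFiniteMeasure (volume.restrict Ω)] {s : ℝ} (hsp : s ≤ p)
    (h : MemW0 Ω p u Du) : MemW0 Ω s u Du := by
  have hle : ENNReal.ofReal s ≤ ENNReal.ofReal p := ENNReal.ofReal_le_ofReal hsp
  obtain ⟨φ, hφ, hlim, hlimD⟩ := h.approx
  exact ⟨h.memLp.mono_exponent hle, h.memLp_grad.mono_exponent hle, φ, hφ,
    tendsto_eLpNorm_zero_of_exponent_le hle
      (fun n => (hφ n).1.continuous.aestronglyMeasurable.sub h.memLp.1) hlim,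
    tendsto_eLpNorm_zero_of_exponent_le hle (fun n =>
      (continuous_gradient (hφ n).1).aestronglyMeasurable.sub h.memLp_grad.1) hlimD⟩

theorem eLpNorm_le (hp : 1 ≤ p) (h : MemW0 Ω p u Du) {r : ENNReal} {S : NNReal}
    (hS : SobolevInequality N (ENNReal.ofReal p) r S) :
    eLpNorm u r (volume.restrict Ω) ≤ S * eLpNorm Du (ENNReal.ofReal p) (volume.restrict Ω) := by
  obtain ⟨φ, hφ, -, hlimD, hae⟩ := h.exists_approx_ae (by linarith)
  have hle : ∀ n, eLpNorm (φ n) r (volume.restrict Ω) ≤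
      S * (eLpNorm (fun x => gradient (φ n) x - Du x) (ENNReal.ofReal p) (volume.restrict Ω)
        + eLpNorm Du (ENNReal.ofReal p) (volume.restrict Ω)) := fun n => by
    have hgrad : eLpNorm (fderiv ℝ (φ n)) (ENNReal.ofReal p) volume =
        eLpNorm (gradient (φ n)) (ENNReal.ofReal p) (volume.restrict Ω) := by
      rw [← eLpNorm_restrict_eq_of_support_subset (f := fderiv ℝ (φ n))
        ((support_fderiv_subset ℝ).trans (hφ n).2.2)]
      exact eLpNorm_congr_norm_ae (ae_of_all _ fun x => (norm_gradient_eq (φ n) x).symm)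
    have htri := eLpNorm_add_le (p := ENNReal.ofReal p)
      ((continuous_gradient (hφ n).1).aestronglyMeasurable.sub h.memLp_grad.1) h.memLp_grad.1
      (by simpa using hp)
    rw [sub_add_cancel] at htri
    refine (eLpNorm_mono_measure _ Measure.restrict_le_self).trans
      ((hS _ (hφ n).1 (hφ n).2.1).trans ?_)
    rw [hgrad]
    gcongr
    exact htri
  have hlim := ENNReal.Tendsto.const_mul (hlimD.add_const
    (eLpNorm Du (ENNReal.ofReal p) (volume.restrict Ω))) (Or.inr (ENNReal.coe_ne_top (r := S)))
  rw [zero_add] at hlim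
  calc eLpNorm u r (volume.restrict Ω)
      ≤ liminf (fun n => eLpNorm (φ n) r (volume.restrict Ω)) atTop :=
        Lp.eLpNorm_lim_le_liminf_eLpNorm
          (fun n => (hφ n).1.continuous.aestronglyMeasurable) u hae
    _ ≤ _ := (liminf_le_liminf (Eventually.of_forall hle)).trans hlim.liminf_eq.le

theorem exists_eLpNorm_le [IsFiniteMeasure (volume.restrict Ω)] {s r : ℝ} {r' : ENNReal}
    {S : NNReal} (hs : 1 ≤ s) (hsp : s ≤ p) (hrr' : ENNReal.ofReal r ≤ r')
    (hS : SobolevInequality N (ENNReal.ofReal s) r' S) : ∃ T : NNReal,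
    ∀ (w : RN N → ℝ) (Dw : RN N → RN N), MemW0 Ω p w Dw →
      eLpNorm w (ENNReal.ofReal r) (volume.restrict Ω) ≤
        T * eLpNorm Dw (ENNReal.ofReal p) (volume.restrict Ω) := by
  obtain ⟨A, hA⟩ := exists_eLpNorm_le_mul (m := volume.restrict Ω) (E := ℝ) hrr'
  obtain ⟨B, hB⟩ := exists_eLpNorm_le_mul (m := volume.restrict Ω) (E := RN N)
    (ENNReal.ofReal_le_ofReal hsp)
  refine ⟨A * (S * B), fun w Dw hw => ?_⟩
  calc eLpNorm w (ENNReal.ofReal r) (volume.restrict Ω)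
      ≤ A * eLpNorm w r' (volume.restrict Ω) := hA w hw.memLp.1
    _ ≤ A * (S * eLpNorm Dw (ENNReal.ofReal s) (volume.restrict Ω)) := by
        gcongr
        exact (hw.mono_exponent hsp).eLpNorm_le hs hS
    _ ≤ A * (S * (B * eLpNorm Dw (ENNReal.ofReal p) (volume.restrict Ω))) := by
        gcongr
        exact hB Dw hw.memLp_grad.1
    _ = _ := by push_cast; ring

theorem eLpNorm_max_sub_le (hp : 1 ≤ p) (h : MemW0 Ω p u Du) (hk : 0 < k) {r : ENNReal}
    {S : NNReal} (hS : ∀ (w : RN N → ℝ) (Dw : RN N → RN N), MemW0 Ω p w Dw →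
      eLpNorm w r (volume.restrict Ω) ≤ S * eLpNorm Dw (ENNReal.ofReal p) (volume.restrict Ω)) :
    eLpNorm (fun x => max (|u x| - k) 0) r (volume.restrict Ω) ≤
      S * eLpNorm Du (ENNReal.ofReal p) ((volume.restrict Ω).restrict {x | k < |u x|}) := by
  calc eLpNorm (fun x => max (|u x| - k) 0) r (volume.restrict Ω)
      = eLpNorm (fun x => u x - trunc k (u x)) r (volume.restrict Ω) :=
        eLpNorm_congr_norm_ae (ae_of_all _ fun x => by
          rw [Real.norm_of_nonneg (le_max_right _ _), Real.norm_eq_abs, abs_sub_trunc hk.le])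
    _ ≤ S * eLpNorm ({x | k < |u x|}.indicator Du) (ENNReal.ofReal p) (volume.restrict Ω) :=
        hS _ _ (h.sub_comp_trunc hp hk)
    _ ≤ _ := by
        rw [← eLpNorm_restrict_eq_of_support_subset Set.support_indicator_subset]
        gcongr
        exact eLpNorm_mono fun x => norm_indicator_le_norm_self Du x

theorem eLpNorm_restrict_level (hp : 0 < p) (h : MemW0 Ω p u Du) (k : ℝ) :
    eLpNorm Du (ENNReal.ofReal p) ((volume.restrict Ω).restrict {x | k < |u x|}) =
      ENNReal.ofReal (levelEnergy (volume.restrict Ω) p u Du k ^ (1 / p)) := by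
  rw [MemLp.eLpNorm_eq_integral_rpow_norm (by simpa using hp) ENNReal.ofReal_ne_top
    (h.memLp_grad.restrict _), ENNReal.toReal_ofReal hp.le, one_div]
  rfl

end MemW0

section ExcessEstimates

variable {N : ℕ} {Ω : Set (RN N)} {p k : ℝ} {u : RN N → ℝ} {Du : RN N → RN N}
  [IsFiniteMeasure (volume.restrict Ω)]

theorem MemW0.excess_one_le_mul (hp : 1 ≤ p) (h : MemW0 Ω p u Du) (hk : 0 < k) {r : ENNReal}
    (hr : 1 ≤ r) {S : NNReal} (hS : SobolevInequality N 1 r S) :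
    excess (volume.restrict Ω) u 1 k ≤ S *
      (levelEnergy (volume.restrict Ω) p u Du k ^ (1 / p) *
        levelMeas (volume.restrict Ω) u k ^ (1 - 1 / p)) *
      levelMeas (volume.restrict Ω) u k ^ (1 - 1 / r.toReal) := by
  set m := volume.restrict Ω
  have hp0 : 0 < p := by linarith
  have hA : 0 ≤ levelMeas m u k := levelMeas_nonneg
  have hG : 0 ≤ levelEnergy m p u Du k := levelEnergy_nonneg
  have hp1 : 0 ≤ 1 - 1 / p := sub_nonneg.2 ((div_le_one hp0).2 hp)
  have hr1 : 0 ≤ 1 - 1 / r.toReal := by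
    rcases eq_or_ne r ⊤ with rfl | hrt
    · simp
    · have : 1 ≤ r.toReal := by simpa using ENNReal.toReal_mono hrt hr
      exact sub_nonneg.2 ((div_le_one (by linarith)).2 this)
  have hint := h.integrable hp
  have hvalues : eLpNorm (fun x => max (|u x| - k) 0) 1 m ≤
      eLpNorm (fun x => max (|u x| - k) 0) r m * m {x | k < |u x|} ^ (1 - 1 / r.toReal) := by
    simpa using eLpNorm_le_mul_rpow_of_support_subset hr (integrable_max_sub hint k).1
      (support_max_sub_subset u k)
  have hgrads : eLpNorm Du 1 (m.restrict {x | k < |u x|}) ≤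
      eLpNorm Du (ENNReal.ofReal p) (m.restrict {x | k < |u x|}) *
        m {x | k < |u x|} ^ (1 - 1 / p) := by
    simpa [ENNReal.toReal_ofReal hp0.le] using eLpNorm_le_eLpNorm_mul_rpow_measure_univ
      (ENNReal.one_le_ofReal.2 hp) (h.memLp_grad.1.restrict (s := {x | k < |u x|}))
  have hsob : eLpNorm (fun x => max (|u x| - k) 0) r m ≤
      S * eLpNorm Du 1 (m.restrict {x | k < |u x|}) := by
    simpa using (h.mono_exponent hp).eLpNorm_max_sub_le le_rfl hk
      fun w Dw hw => hw.eLpNorm_le le_rfl (by simpa using hS)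
  have hexcess := eLpNorm_max_sub one_pos (by simpa [memLp_one_iff_integrable] using hint) k
  rw [ENNReal.ofReal_one, div_one, Real.rpow_one] at hexcess
  rw [← ENNReal.ofReal_le_ofReal_iff (by positivity), ← hexcess]
  calc eLpNorm (fun x => max (|u x| - k) 0) 1 m
      ≤ S * (eLpNorm Du (ENNReal.ofReal p) (m.restrict {x | k < |u x|}) *
          m {x | k < |u x|} ^ (1 - 1 / p)) * m {x | k < |u x|} ^ (1 - 1 / r.toReal) := by
        grw [hvalues, hsob, hgrads]
    _ = _ := by
        rw [h.eLpNorm_restrict_level hp0, ← ofReal_levelMeas,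
          ENNReal.ofReal_rpow_of_nonneg hA hp1, ENNReal.ofReal_rpow_of_nonneg hA hr1,
          ENNReal.ofReal_mul (by positivity), ENNReal.ofReal_mul (by positivity),
          ENNReal.ofReal_mul (by positivity), ENNReal.ofReal_coe_nnreal]

end ExcessEstimates

/-- `C` is a constant in the bound of the excess over a level by the measure of the set above this
level and by the energy above this level, for all `Ω`, `p` and `u ∈ W^{1,p}_0(Ω)`. -/
def IsExcessConst (N : ℕ) (C : ℝ) : Prop :=
  ∀ (Ω : Set (RN N)) (p : ℝ) (u : RN N → ℝ) (Du : RN N → RN N) (k : ℝ), volume Ω < ⊤ → 1 ≤ p →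
    MemW0 Ω p u Du → 0 < k → excess (volume.restrict Ω) u 1 k ^ p ≤
      C ^ p * levelMeas (volume.restrict Ω) u k ^ (p - 1 + p / N) *
        levelEnergy (volume.restrict Ω) p u Du k

theorem exists_isExcessConst {N : ℕ} (hN : 1 ≤ N) : ∃ C : ℝ, 0 < C ∧ IsExcessConst N C := by
  obtain ⟨r, S, hr, hrN, hS⟩ := exists_sobolevInequality_one hN
  refine ⟨S + 1, by positivity, fun Ω p u Du k hΩ hp h hk => ?_⟩
  have : IsFiniteMeasure (volume.restrict Ω) := ⟨by simpa using hΩ⟩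
  have hp0 : 0 < p := by linarith
  have hA : 0 ≤ levelMeas (volume.restrict Ω) u k := levelMeas_nonneg
  have hG : 0 ≤ levelEnergy (volume.restrict Ω) p u Du k := levelEnergy_nonneg
  have hle := h.excess_one_le_mul hp hk hr hS
  rw [hrN] at hle
  set A := levelMeas (volume.restrict Ω) u k
  set G := levelEnergy (volume.restrict Ω) p u Du k
  calc excess (volume.restrict Ω) u 1 k ^ p
      ≤ ((S + 1) * (G ^ (1 / p) * A ^ (1 - 1 / p)) * A ^ (1 / (N : ℝ))) ^ p := by
        refine Real.rpow_le_rpow excess_nonneg (hle.trans ?_) hp0.le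
        gcongr
        exact le_add_of_nonneg_right zero_le_one
    _ = (S + 1) ^ p * A ^ (p - 1 + p / N) * G := by
        rw [Real.mul_rpow (by positivity) (by positivity),
          Real.mul_rpow (by positivity) (by positivity),
          Real.mul_rpow (by positivity) (by positivity), ← Real.rpow_mul hG, ← Real.rpow_mul hA,
          ← Real.rpow_mul hA, Real.rpow_add_of_nonneg hA (by linarith) (by positivity),
          one_div_mul_cancel hp0.ne', Real.rpow_one, sub_mul, one_mul, one_div_mul_cancel hp0.ne',
          one_div_mul_eq_div]
        ring

theorem exists_rpow_excess_le {N : ℕ} {Ω : Set (RN N)} {p q : ℝ} (hN : 1 ≤ N)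
    (hΩ : volume Ω < ⊤) (hp : 1 ≤ p) (hpN : p ≤ N) (hq : (q : EReal) ≤ critExp N p) :
    ∃ r S : ℝ, p < r ∧ q ≤ r ∧ 0 ≤ S ∧ ∀ (u : RN N → ℝ) (Du : RN N → RN N), MemW0 Ω p u Du →
      MemLp u (ENNReal.ofReal r) (volume.restrict Ω) ∧ ∀ k, 0 < k →
        excess (volume.restrict Ω) u r k ^ (p / r) ≤
          S * levelEnergy (volume.restrict Ω) p u Du k := by
  have : IsFiniteMeasure (volume.restrict Ω) := ⟨by simpa using hΩ⟩
  have hp0 : 0 < p := by linarith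
  obtain ⟨s, r, r', S, hs, hsp, hpr, hqr, hrr', hS⟩ :=
    exists_sobolevInequality_of_le_critExp hN hp hpN hq
  obtain ⟨T, hT⟩ := MemW0.exists_eLpNorm_le (Ω := Ω) hs hsp hrr' hS
  have hr0 : 0 < r := by linarith
  refine ⟨r, T ^ p, hpr, hqr, by positivity, fun u Du h => ?_⟩
  have hu : MemLp u (ENNReal.ofReal r) (volume.restrict Ω) := ⟨h.memLp.1,
    (hT u Du h).trans_lt (ENNReal.mul_lt_top ENNReal.coe_lt_top h.memLp_grad.2)⟩
  refine ⟨hu, fun k hk => ?_⟩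
  have hE : 0 ≤ excess (volume.restrict Ω) u r k := excess_nonneg
  have hG : 0 ≤ levelEnergy (volume.restrict Ω) p u Du k := levelEnergy_nonneg
  have hle := h.eLpNorm_max_sub_le hp hk hT
  rw [eLpNorm_max_sub hr0 hu, h.eLpNorm_restrict_level hp0, ← ENNReal.ofReal_coe_nnreal,
    ← ENNReal.ofReal_mul T.coe_nonneg, ENNReal.ofReal_le_ofReal_iff (by positivity)] at hle
  calc excess (volume.restrict Ω) u r k ^ (p / r)
      = (excess (volume.restrict Ω) u r k ^ (1 / r)) ^ p := by
        rw [← Real.rpow_mul hE, one_div_mul_eq_div]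
    _ ≤ (T * levelEnergy (volume.restrict Ω) p u Du k ^ (1 / p)) ^ p := by gcongr
    _ = T ^ p * levelEnergy (volume.restrict Ω) p u Du k := by
        rw [Real.mul_rpow T.coe_nonneg (by positivity), ← Real.rpow_mul hG,
          one_div_mul_cancel hp0.ne', Real.rpow_one]

section Minimizers

variable {α : Type*} [MeasurableSpace α] {m : Measure α}

theorem extIntegral_eq_integral {g : α → ℝ} (hg : Integrable g m) :
    extIntegral m g = ((∫ x, g x ∂m : ℝ) : EReal) := by
  rw [extIntegral, integral_eq_lintegral_pos_part_sub_lintegral_neg_part hg, EReal.coe_sub,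
    EReal.coe_ennreal_toReal hg.lintegral_lt_top.ne,
    EReal.coe_ennreal_toReal (x := ∫⁻ x, ENNReal.ofReal (-g x) ∂m) hg.neg.lintegral_lt_top.ne]

theorem integrable_of_extIntegral_lt_top {h g : α → ℝ} (hh : ∀ x, 0 ≤ h x)
    (hm : AEStronglyMeasurable h m) (hg : Integrable g m)
    (hlt : extIntegral m (fun x => h x - g x) < ⊤) : Integrable h m := by
  have hneg : ∫⁻ x, ENNReal.ofReal (-(h x - g x)) ∂m < ⊤ :=
    (lintegral_mono fun x => ENNReal.ofReal_le_ofReal (by linarith [hh x])).trans_lt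
      hg.lintegral_lt_top
  have hpos : ∫⁻ x, ENNReal.ofReal (h x - g x) ∂m < ⊤ := by
    by_contra htop
    rw [not_lt, top_le_iff] at htop
    rw [extIntegral, htop, ← ENNReal.ofReal_toReal hneg.ne] at hlt
    simp [EReal.coe_ennreal_ofReal] at hlt
  refine (lintegral_ofReal_ne_top_iff_integrable hm (ae_of_all _ hh)).1 (ne_of_lt ?_)
  calc ∫⁻ x, ENNReal.ofReal (h x) ∂m
      ≤ ∫⁻ x, (ENNReal.ofReal (h x - g x) + ENNReal.ofReal (g x)) ∂m :=
        lintegral_mono fun x => by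
          simpa using ENNReal.ofReal_add_le (p := h x - g x) (q := g x)
    _ = ∫⁻ x, ENNReal.ofReal (h x - g x) ∂m + ∫⁻ x, ENNReal.ofReal (g x) ∂m :=
        lintegral_add_left' (hm.sub hg.1).aemeasurable.ennreal_ofReal _
    _ < ⊤ := ENNReal.add_lt_top.2 ⟨hpos, hg.lintegral_lt_top⟩

theorem integrable_mul_trunc {g u : α → ℝ} (hu : AEStronglyMeasurable u m)
    (hgu : Integrable (fun x => g x * u x) m) {k : ℝ} (hk : 0 ≤ k) :
    Integrable (fun x => g x * trunc k (u x)) m := by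
  have hm : AEStronglyMeasurable (fun x => trunc k (u x) / u x) m :=
    (((continuous_trunc k).measurable.comp_aemeasurable hu.aemeasurable).div
      hu.aemeasurable).aestronglyMeasurable
  have heq : (fun x => g x * trunc k (u x)) = fun x => g x * u x * (trunc k (u x) / u x) := by
    ext x
    rcases eq_or_ne (u x) 0 with h0 | h0
    · simp [h0, trunc_of_abs_le (k := k) (t := 0) (by simpa using hk)]
    · field_simp
  refine hgu.mono (heq ▸ hgu.1.mul hm) (ae_of_all _ fun x => ?_)
  rw [norm_mul, norm_mul]
  exact mul_le_mul_of_nonneg_left (abs_trunc_le_abs hk) (norm_nonneg _)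

theorem integrable_comp_indicator_compl {E : Type*} [Zero E] [IsFiniteMeasure m] {G : E → ℝ}
    {w : α → E} {s : Set α} (hs : NullMeasurableSet s m) (hGw : Integrable (fun x => G (w x)) m) :
    Integrable (fun x => G (sᶜ.indicator w x)) m ∧
      ∫ x, G (sᶜ.indicator w x) ∂m = G 0 * m.real s + ∫ x, G (w x) ∂m - ∫ x in s, G (w x) ∂m := by
  have heq : (fun x => G (sᶜ.indicator w x)) =
      fun x => s.indicator (fun _ => G 0) x + sᶜ.indicator (fun x => G (w x)) x := by
    ext x
    by_cases hx : x ∈ s <;> simp [hx]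
  have hconst : Integrable (s.indicator fun _ => G 0) m := (integrable_const _).indicator₀ hs
  have hcompl : Integrable (sᶜ.indicator fun x => G (w x)) m := hGw.indicator₀ hs.compl
  refine ⟨heq ▸ hconst.add hcompl, ?_⟩
  rw [heq, integral_add hconst hcompl, integral_indicator₀ hs, integral_indicator₀ hs.compl,
    setIntegral_const, smul_eq_mul, ← integral_add_compl₀ hs hGw]
  ring

/-- A measurable integrand `H` of the energy with the `p`-coercivity `H(z) ≥ c |z|^p`, `c > 0`. -/
structure CoerciveIntegrand {E : Type*} [Norm E] [MeasurableSpace E] (p c : ℝ) (H : E → ℝ) :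
    Prop where
  pos : 0 < c
  measurable : Measurable H
  le : ∀ z, c * ‖z‖ ^ p ≤ H z

theorem CoerciveIntegrand.nonneg {E : Type*} [SeminormedAddCommGroup E] [MeasurableSpace E]
    {p c : ℝ} {H : E → ℝ} (hH : CoerciveIntegrand p c H) (z : E) : 0 ≤ H z :=
  (mul_nonneg hH.pos.le (by positivity)).trans (hH.le z)

/-- `u ∈ W^{1,p}_0(Ω)`, with weak gradient `Du`, minimises `∫_Ω H(Dv) - g v dx` among all
`v ∈ W^{1,p}_0(Ω)` with `g v ∈ L^1(Ω)`. For `g = f(·, u)` this is the semi-linearised problem which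
defines the energy critical points. -/
structure IsSourceMinimizer {N : ℕ} (Ω : Set (RN N)) (p : ℝ) (H : RN N → ℝ) (g u : RN N → ℝ)
    (Du : RN N → RN N) : Prop where
  mem : MemW0 Ω p u Du
  integrable : Integrable (fun x => g x * u x) (volume.restrict Ω)
  minimal : ∀ (v : RN N → ℝ) (Dv : RN N → RN N), MemW0 Ω p v Dv →
    Integrable (fun x => g x * v x) (volume.restrict Ω) →
    extIntegral (volume.restrict Ω) (fun x => H (Du x) - g x * u x) ≤
      extIntegral (volume.restrict Ω) (fun x => H (Dv x) - g x * v x)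

namespace IsSourceMinimizer

variable {N : ℕ} {Ω : Set (RN N)} {p c k : ℝ} {H : RN N → ℝ} {g u : RN N → ℝ} {Du : RN N → RN N}
  [IsFiniteMeasure (volume.restrict Ω)]

theorem integrable_comp_grad (hp : 1 ≤ p) (hH : CoerciveIntegrand p c H)
    (h : IsSourceMinimizer Ω p H g u Du) : Integrable (fun x => H (Du x)) (volume.restrict Ω) := by
  have hzero : MemW0 Ω p (fun _ => 0) (fun _ => 0) := by
    simpa using h.mem.comp_smooth hp (η := fun _ => 0) contDiff_const rfl (by simp)
  refine integrable_of_extIntegral_lt_top (fun x => hH.nonneg _)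
    (hH.measurable.comp_aemeasurable h.mem.memLp_grad.1.aemeasurable).aestronglyMeasurable
    h.integrable ?_
  refine (h.minimal _ _ hzero (by simp)).trans_lt ?_
  simp only [mul_zero, sub_zero]
  rw [extIntegral_eq_integral (integrable_const _)]
  exact EReal.coe_lt_top _

theorem mul_levelEnergy_le (hp : 1 ≤ p) (hH : CoerciveIntegrand p c H)
    (h : IsSourceMinimizer Ω p H g u Du) (hk : 0 < k) :
    c * levelEnergy (volume.restrict Ω) p u Du k ≤ H 0 * levelMeas (volume.restrict Ω) u k +
      ∫ x in Ω, g x * (u x - trunc k (u x)) := by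
  have hHu := h.integrable_comp_grad hp hH
  have hgT := integrable_mul_trunc h.mem.memLp.1 h.integrable hk.le
  obtain ⟨hHT, hHT_eq⟩ :=
    integrable_comp_indicator_compl (nullMeasurableSet_level h.mem.memLp.1 k) hHu
  have hcompl : {x | k < |u x|}ᶜ = {x | |u x| ≤ k} := by ext x; simp
  rw [hcompl] at hHT hHT_eq
  have hmin := h.minimal _ _ (h.mem.comp_trunc hp hk) hgT
  rw [extIntegral_eq_integral (hHu.sub' h.integrable),
    extIntegral_eq_integral (hHT.sub' hgT),
    EReal.coe_le_coe_iff, integral_sub hHu h.integrable, integral_sub hHT hgT, hHT_eq] at hmin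
  have hcoercive : c * levelEnergy (volume.restrict Ω) p u Du k
      ≤ ∫ x in {x | k < |u x|}, H (Du x) ∂volume.restrict Ω := by
    rw [levelEnergy, ← integral_const_mul]
    exact integral_mono_of_nonneg (ae_of_all _ fun x => mul_nonneg hH.pos.le (by positivity))
      hHu.integrableOn (ae_of_all _ fun x => hH.le _)
  simp only [mul_sub]
  rw [integral_sub h.integrable hgT, levelMeas]
  linarith

theorem mul_levelEnergy_le_of_sign_mul_le (hp : 1 ≤ p) (hH : CoerciveIntegrand p c H)
    (h : IsSourceMinimizer Ω p H g u Du) (hk : 0 < k) {w : RN N → ℝ}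
    (hw : Integrable w (volume.restrict Ω))
    (hle : ∀ᵐ x ∂volume.restrict Ω, Real.sign (u x) * g x * max (|u x| - k) 0 ≤ w x) :
    c * levelEnergy (volume.restrict Ω) p u Du k ≤
      H 0 * levelMeas (volume.restrict Ω) u k + ∫ x in Ω, w x := by
  refine (h.mul_levelEnergy_le hp hH hk).trans (add_le_add le_rfl (integral_mono_ae ?_ hw ?_))
  · simp only [mul_sub]
    exact h.integrable.sub (integrable_mul_trunc h.mem.memLp.1 h.integrable hk.le)
  · filter_upwards [hle] with x hx
    rwa [sub_trunc hk.le, ← mul_assoc, mul_comm (g x)]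

end IsSourceMinimizer

end Minimizers

section Boundedness

theorem eventually_excess_rpow_le_of_absorb {α : Type*} [MeasurableSpace α] {m : Measure α}
    [IsFiniteMeasure m] {u : α → ℝ} {p r K : ℝ} {R : ℝ → ℝ} (hp : 0 ≤ p) (hpr : p < r)
    (hu : MemLp u (ENNReal.ofReal r) m)
    (h : ∀ᶠ k in atTop, excess m u r k ^ (p / r) ≤ R k + K * excess m u r k) :
    ∀ᶠ k in atTop, excess m u r k ^ (p / r) ≤ 2 * R k := by
  have hr : 0 < r := hp.trans_lt hpr
  have hexp : 0 < 1 - p / r := sub_pos.2 ((div_lt_one hr).2 hpr)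
  have hlim : Tendsto (fun k => K * excess m u r k ^ (1 - p / r)) atTop (𝓝 0) := by
    simpa [Real.zero_rpow hexp.ne'] using
      ((tendsto_excess_atTop hr hu).rpow_const (.inr hexp.le)).const_mul K
  filter_upwards [h, hlim.eventually_le_const one_half_pos] with k hk hsmall
  have hsplit : excess m u r k = excess m u r k ^ (1 - p / r) * excess m u r k ^ (p / r) := by
    rw [← Real.rpow_add_of_nonneg excess_nonneg hexp.le (by positivity)]
    simp
  have habsorb : K * excess m u r k ≤ 1 / 2 * excess m u r k ^ (p / r) := by
    rw [hsplit, ← mul_assoc, ← hsplit]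
    exact mul_le_mul_of_nonneg_right hsmall (Real.rpow_nonneg excess_nonneg _)
  linarith

theorem add_rpow_mul_max_sub_le {θ q r k t : ℝ} (hθ : 0 ≤ θ) (hqr : q ≤ r) (hr : 1 ≤ r)
    (hk : 1 ≤ k) (hθk : θ ≤ k) : (t + θ) ^ (q - 1) * max (t - k) 0 ≤
      4 ^ (r - 1) * (max (t - k) 0 ^ r + k ^ (r - 1) * max (t - k) 0) := by
  rcases le_or_gt t k with h | h
  · rw [max_eq_right (by linarith), mul_zero]
    positivity
  have hr1 : 0 ≤ r - 1 := by linarith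
  obtain ⟨w, rfl⟩ : ∃ w, t = w + k := ⟨t - k, by ring⟩
  have hw : 0 < w := by linarith
  rw [add_sub_cancel_right, max_eq_left hw.le]
  have hmax : max w k ^ (r - 1) ≤ w ^ (r - 1) + k ^ (r - 1) := by
    rw [(Real.monotoneOn_rpow_Ici_of_exponent_nonneg hr1).map_max hw.le (by linarith : 0 ≤ k)]
    exact max_le_add_of_nonneg (by positivity) (by positivity)
  calc (w + k + θ) ^ (q - 1) * w ≤ (w + k + θ) ^ (r - 1) * w := by gcongr; linarith
    _ ≤ (4 * max w k) ^ (r - 1) * w := by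
        gcongr
        linarith [le_max_left w k, le_max_right w k]
    _ = 4 ^ (r - 1) * (max w k ^ (r - 1) * w) := by
        rw [Real.mul_rpow (by norm_num) (by positivity), mul_assoc]
    _ ≤ 4 ^ (r - 1) * ((w ^ (r - 1) + k ^ (r - 1)) * w) := by gcongr
    _ = 4 ^ (r - 1) * (w ^ r + k ^ (r - 1) * w) := by
        rw [add_mul, ← Real.rpow_add_one hw.ne', sub_add_cancel]

variable {N : ℕ} {Ω : Set (RN N)} {p c : ℝ} {H : RN N → ℝ} {g u : RN N → ℝ} {Du : RN N → RN N}

theorem MemW0.levelEnergy_le (hp : 1 ≤ p) (h : MemW0 Ω p u Du) (k : ℝ) :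
    levelEnergy (volume.restrict Ω) p u Du k ≤ ∫ x in Ω, ‖Du x‖ ^ p := by
  have hint := h.memLp_grad.integrable_norm_rpow (by simpa using by linarith) ENNReal.ofReal_ne_top
  rw [ENNReal.toReal_ofReal (by linarith)] at hint
  exact setIntegral_le_integral hint (ae_of_all _ fun x => by positivity)

theorem MemW0.memLp_top (hN : 1 ≤ N) (hΩ : volume Ω < ⊤) (hp : 1 ≤ p) (hNp : (N : ℝ) < p)
    (h : MemW0 Ω p u Du) : MemLp u ⊤ (volume.restrict Ω) := by
  have : IsFiniteMeasure (volume.restrict Ω) := ⟨by simpa using hΩ⟩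
  have hN0 : (0 : ℝ) < N := by exact_mod_cast hN
  have hpN : 1 < p / N := (one_lt_div hN0).2 hNp
  obtain ⟨C, hC, hle⟩ := exists_isExcessConst hN
  refine memLp_top_of_bound h.memLp.1 _ (ae_abs_le_of_excess_rpow_le (h.integrable hp) (k := 1)
    (a := p) (D := p - 1 + p / N) (B := C ^ p * ∫ x in Ω, ‖Du x‖ ^ p) (by linarith) (by linarith)
    (by positivity) fun k hk _ => ?_)
  have hA : 0 ≤ levelMeas (volume.restrict Ω) u k := levelMeas_nonneg
  calc _ ≤ _ := hle Ω p u Du k hΩ hp h (by linarith)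
    _ ≤ _ := by
      rw [mul_right_comm]
      gcongr
      exact h.levelEnergy_le hp k

namespace IsSourceMinimizer

theorem mul_levelEnergy_le_of_growth [IsFiniteMeasure (volume.restrict Ω)] (hp : 1 ≤ p)
    (hH : CoerciveIntegrand p c H) (h : IsSourceMinimizer Ω p H g u Du) {μ θ q r k : ℝ}
    (hμ : 0 ≤ μ) (hθ : 0 ≤ θ) (hqr : q ≤ r) (hr : 1 ≤ r) (hk : 1 ≤ k) (hθk : θ ≤ k)
    (hur : MemLp u (ENNReal.ofReal r) (volume.restrict Ω))
    (hg : ∀ᵐ x ∂volume.restrict Ω, Real.sign (u x) * g x ≤ μ * (|u x| + θ) ^ (q - 1)) :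
    c * levelEnergy (volume.restrict Ω) p u Du k ≤ H 0 * levelMeas (volume.restrict Ω) u k +
      μ * 4 ^ (r - 1) * (excess (volume.restrict Ω) u r k +
        k ^ (r - 1) * excess (volume.restrict Ω) u 1 k) := by
  have hi := integrable_max_sub_rpow (by linarith) hur k
  have hi1 := (integrable_max_sub (h.mem.integrable hp) k).const_mul (k ^ (r - 1))
  rw [excess_one, excess, ← integral_const_mul, ← integral_add hi hi1, ← integral_const_mul]
  refine h.mul_levelEnergy_le_of_sign_mul_le hp hH (by linarith) ((hi.add hi1).const_mul _) ?_
  filter_upwards [hg] with x hx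
  calc _ ≤ μ * (|u x| + θ) ^ (q - 1) * max (|u x| - k) 0 := by gcongr
    _ ≤ _ := by
      rw [mul_assoc, mul_assoc]
      exact mul_le_mul_of_nonneg_left (add_rpow_mul_max_sub_le hθ hqr hr hk hθk) hμ

theorem memLp_top_of_growth (hN : 1 ≤ N) (hΩ : volume Ω < ⊤) (hp : 1 ≤ p) (hpN : p ≤ N)
    (hH : CoerciveIntegrand p c H) (h : IsSourceMinimizer Ω p H g u Du) {μ θ q : ℝ} (hμ : 0 ≤ μ)
    (hθ : 0 ≤ θ) (hqc : (q : EReal) ≤ critExp N p)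
    (hg : ∀ᵐ x ∂volume.restrict Ω, Real.sign (u x) * g x ≤ μ * (|u x| + θ) ^ (q - 1)) :
    MemLp u ⊤ (volume.restrict Ω) := by
  have : IsFiniteMeasure (volume.restrict Ω) := ⟨by simpa using hΩ⟩
  obtain ⟨r, S, hpr, hqr, hS, hSob⟩ := exists_rpow_excess_le hN hΩ hp hpN hqc
  obtain ⟨hur, hSob⟩ := hSob u Du h.mem
  have hc := hH.pos
  have hH0 := hH.nonneg 0
  set m := volume.restrict Ω
  set B := μ * 4 ^ (r - 1)
  have : 0 ≤ B := by positivity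
  have hlevel : ∀ᶠ k in atTop, excess m u r k ^ (p / r) ≤
      S / c * (H 0 + B) * (levelMeas m u k + k ^ (r - 1) * excess m u 1 k) +
        S / c * B * excess m u r k := by
    filter_upwards [eventually_ge_atTop 1, eventually_ge_atTop θ] with k hk hθk
    have hA : 0 ≤ levelMeas m u k := levelMeas_nonneg
    have hφ : 0 ≤ excess m u 1 k := excess_nonneg
    have hE := h.mul_levelEnergy_le_of_growth hp hH hμ hθ hqr (by linarith) hk hθk hur hg
    calc excess m u r k ^ (p / r) ≤ S * levelEnergy m p u Du k := hSob k (by linarith)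
      _ = S / c * (c * levelEnergy m p u Du k) := by field_simp
      _ ≤ S / c * (H 0 * levelMeas m u k + B * (excess m u r k + k ^ (r - 1) * excess m u 1 k)) :=
          by gcongr
      _ ≤ S / c * (H 0 * (levelMeas m u k + k ^ (r - 1) * excess m u 1 k) +
            B * (excess m u r k + (levelMeas m u k + k ^ (r - 1) * excess m u 1 k))) := by
          gcongr
          · exact le_add_of_nonneg_right (by positivity)
          · exact le_add_of_nonneg_left hA
      _ = _ := by ring
  refine memLp_top_of_eventually_excess_le hp hpr hur (Q := 2 * (S / c * (H 0 + B)))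
    (by positivity) ?_
  simpa only [mul_assoc] using eventually_excess_rpow_le_of_absorb (by linarith) hpr hur hlevel

theorem memLp_top (hN : 1 ≤ N) (hΩ : volume Ω < ⊤) (hp : 1 ≤ p) (hH : CoerciveIntegrand p c H)
    (h : IsSourceMinimizer Ω p H g u Du)
    (hg : p ≤ N → ∃ μ θ q : ℝ, 0 ≤ μ ∧ 0 ≤ θ ∧ (q : EReal) ≤ critExp N p ∧
      ∀ᵐ x ∂volume.restrict Ω, Real.sign (u x) * g x ≤ μ * (|u x| + θ) ^ (q - 1)) :
    MemLp u ⊤ (volume.restrict Ω) := by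
  rcases le_or_gt p N with hpN | hpN
  · obtain ⟨μ, θ, q, hμ, hθ, hqc, hg⟩ := hg hpN
    exact h.memLp_top_of_growth hN hΩ hp hpN hH hμ hθ hqc hg
  · exact h.mem.memLp_top hN hΩ hp hpN

end IsSourceMinimizer

end Boundedness

section QuantitativeEstimate

theorem bound_exponent_pos {N : ℕ} (hN : 1 ≤ N) {p q : ℝ} (hp : 1 ≤ p) (hq : 1 ≤ q)
    (hqc : (q : EReal) < critExp N p) : 0 < p * q + (p - q) * N := by
  have hN0 : (0 : ℝ) < N := by exact_mod_cast hN
  rcases lt_or_ge p N with hlt | hle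
  · rw [critExp, if_pos hlt, EReal.coe_lt_coe_iff, lt_div_iff₀ (sub_pos.2 hlt)] at hqc
    linarith
  · nlinarith [mul_nonneg (sub_nonneg.2 hle) (by linarith : 0 ≤ q)]

/-- The constant `C(N, p, q)` of the quantitative estimate, in terms of a constant `S` with
`IsExcessConst N S`. -/
noncomputable def boundConst (N : ℕ) (S p q : ℝ) : ℝ :=
  2 * (S ^ p * 4 ^ (q - 1) *
    (2 ^ (p / N / (p - 1 + p / N)) - 1) ^ (-(p - 1 + p / N))) ^ (N / (p * q + (p - q) * N))

theorem two_rpow_div_sub_one_pos {N : ℕ} (hN : 1 ≤ N) {p : ℝ} (hp : 1 ≤ p) :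
    0 < (2 : ℝ) ^ (p / N / (p - 1 + p / N)) - 1 := by
  have : (0 : ℝ) < N := by exact_mod_cast hN
  have hpN : 0 < p / N := by positivity
  exact two_rpow_sub_one_pos (div_pos hpN (by linarith))

theorem boundConst_pos {N : ℕ} (hN : 1 ≤ N) {S p q : ℝ} (hS : 0 < S) (hp : 1 ≤ p) :
    0 < boundConst N S p q := by
  have := two_rpow_div_sub_one_pos hN hp
  unfold boundConst
  positivity

theorem continuousOn_boundConst {N : ℕ} (hN : 1 ≤ N) {S : ℝ} (hS : 0 < S) :
    ContinuousOn (fun z : ℝ × ℝ => boundConst N S z.1 z.2) (subcritical N) := by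
  intro z ⟨hp, hq, hqc⟩
  have hN0 : (0 : ℝ) < N := by exact_mod_cast hN
  have hpN : 0 < z.1 / N := div_pos (zero_lt_one.trans_le hp) hN0
  have hD : z.1 - 1 + z.1 / N ≠ 0 := by linarith
  have hP := bound_exponent_pos hN hp hq hqc
  have hδ := two_rpow_div_sub_one_pos hN hp
  have hcD : ContinuousAt (fun z : ℝ × ℝ => z.1 - 1 + z.1 / N) z := by fun_prop
  have hcδ : ContinuousAt (fun z : ℝ × ℝ => (2 : ℝ) ^ (z.1 / N / (z.1 - 1 + z.1 / N)) - 1) z :=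
    (ContinuousAt.rpow continuousAt_const ((continuousAt_fst.div_const _).div hcD hD)
      (.inl two_ne_zero)).sub continuousAt_const
  have hcS : ContinuousAt (fun z : ℝ × ℝ => S ^ z.1 * 4 ^ (z.2 - 1)) z :=
    (ContinuousAt.rpow continuousAt_const continuousAt_fst (.inl hS.ne')).mul
      (ContinuousAt.rpow continuousAt_const (by fun_prop) (.inl four_ne_zero))
  refine (continuousAt_const.mul (ContinuousAt.rpow
    (hcS.mul (ContinuousAt.rpow hcδ hcD.neg (.inl hδ.ne')))
    (continuousAt_const.div (by fun_prop) hP.ne') (.inl ?_))).continuousWithinAt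
  exact (mul_pos (by positivity) (Real.rpow_pos_of_pos hδ _)).ne'

theorem rpow_le_of_le_mul_rpow_div {x y B b D δ : ℝ} (hx : 0 ≤ x) (hy : 0 ≤ y) (hB : 0 ≤ B)
    (hδ : 0 < δ) (hD : 0 < D) (h : x ≤ B ^ (1 / D) * (y ^ (b / D) / δ)) :
    x ^ D ≤ B * y ^ b * δ ^ (-D) :=
  calc x ^ D ≤ (B ^ (1 / D) * (y ^ (b / D) / δ)) ^ D := Real.rpow_le_rpow hx h hD.le
    _ = B * y ^ b * δ ^ (-D) := by
      rw [Real.mul_rpow (by positivity) (by positivity), Real.div_rpow (by positivity) hδ.le,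
        ← Real.rpow_mul hB, ← Real.rpow_mul hy, one_div_mul_cancel hD.ne', Real.rpow_one,
        div_mul_cancel₀ _ hD.ne', Real.rpow_neg hδ.le]
      ring

theorem le_rpow_mul_rpow_of_rpow_div_le {x y a b n P : ℝ} (hx : 0 ≤ x) (hy : 0 ≤ y) (ha : 0 ≤ a)
    (hn : 0 < n) (hP : 0 < P) (h : x ^ (P / n) ≤ a * y ^ (b / n)) :
    x ≤ a ^ (n / P) * y ^ (b / P) :=
  calc x = (x ^ (P / n)) ^ (n / P) := by
        rw [← Real.rpow_mul hx, div_mul_div_cancel₀ hn.ne', div_self hP.ne', Real.rpow_one]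
    _ ≤ (a * y ^ (b / n)) ^ (n / P) := by gcongr
    _ = a ^ (n / P) * y ^ (b / P) := by
        rw [Real.mul_rpow ha (by positivity), ← Real.rpow_mul hy, div_mul_div_cancel₀ hn.ne']

theorem two_mul_le_boundConst_mul {N : ℕ} (hN : 1 ≤ N) {S p q t I x : ℝ} (hS : 0 < S)
    (hp : 1 ≤ p) (hx : 0 < x) (hI : 0 ≤ I) (ht : 0 ≤ t) (hP : 0 < p * q + (p - q) * N)
    (h : x ≤ (S ^ p * t * (4 * x) ^ (q - 1)) ^ (1 / (p - 1 + p / N)) *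
      ((x ^ (1 - q) * I) ^ (p / N / (p - 1 + p / N)) /
        (2 ^ (p / N / (p - 1 + p / N)) - 1))) :
    2 * x ≤ boundConst N S p q * (t ^ ((N : ℝ) / p) * I) ^ (p / (p * q + (p - q) * N)) := by
  have hN0 : (0 : ℝ) < N := by exact_mod_cast hN
  have hp0 : 0 < p := by linarith
  have hpN : 0 < p / N := by positivity
  have hδ := two_rpow_div_sub_one_pos hN hp
  have hpow := rpow_le_of_le_mul_rpow_div hx.le (by positivity) (by positivity) hδ
    (by linarith) h
  have hbound : x ^ ((p * q + (p - q) * N) / N) ≤ S ^ p * 4 ^ (q - 1) *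
      (2 ^ (p / N / (p - 1 + p / N)) - 1) ^ (-(p - 1 + p / N)) *
        (t ^ ((N : ℝ) / p) * I) ^ (p / N) := by
    have hexp : (p * q + (p - q) * N) / N = p - 1 + p / N - (q - 1 + (1 - q) * (p / N)) := by
      field_simp
      ring
    have ht' : (t ^ ((N : ℝ) / p)) ^ (p / N) = t := by
      rw [← Real.rpow_mul ht, div_mul_div_cancel₀ hp0.ne', div_self hN0.ne', Real.rpow_one]
    rw [hexp, Real.rpow_sub hx, div_le_iff₀ (by positivity)]
    refine hpow.trans_eq ?_
    rw [Real.mul_rpow (by norm_num) hx.le, Real.mul_rpow (by positivity) hI,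
      Real.mul_rpow (by positivity) hI, ht', ← Real.rpow_mul hx.le, Real.rpow_add hx]
    ring
  rw [boundConst, mul_assoc]
  exact mul_le_mul_of_nonneg_left
    (le_rpow_mul_rpow_of_rpow_div_le hx.le (by positivity) (by positivity) hN0 hP hbound) two_pos.le

theorem excess_one_le_rpow_mul_integral {α : Type*} [MeasurableSpace α] {m : Measure α}
    [IsFiniteMeasure m] {u : α → ℝ} {q h : ℝ} (hq : 1 ≤ q) (hu : MemLp u (ENNReal.ofReal q) m)
    (hh : 0 < h) : excess m u 1 h ≤ h ^ (1 - q) * ∫ x, |u x| ^ q ∂m := by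
  have hle := rpow_mul_excess_one_le (k := 0) hq hu hh.le
  rw [zero_add, excess_zero_right] at hle
  calc excess m u 1 h = h ^ (1 - q) * (h ^ (q - 1) * excess m u 1 h) := by
        rw [← mul_assoc, ← Real.rpow_add hh]
        simp
    _ ≤ h ^ (1 - q) * ∫ x, |u x| ^ q ∂m := by gcongr

namespace IsSourceMinimizer

variable {N : ℕ} {Ω : Set (RN N)} {p c S μ θ q : ℝ} {H : RN N → ℝ} {g u : RN N → ℝ}
  {Du : RN N → RN N}

theorem excess_one_rpow_le (hS : IsExcessConst N S) (hS0 : 0 ≤ S) (hΩ : volume Ω < ⊤) (hp : 1 ≤ p)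
    (hH : CoerciveIntegrand p c H) (hH0 : H 0 = 0) (h : IsSourceMinimizer Ω p H g u Du)
    (hμ : 0 ≤ μ) (hθ : 0 ≤ θ) (hq : 1 ≤ q)
    (hg : ∀ᵐ x ∂volume.restrict Ω, Real.sign (u x) * g x ≤ μ * (|u x| + θ) ^ (q - 1)) {M k : ℝ}
    (hM : ∀ᵐ x ∂volume.restrict Ω, |u x| ≤ M) (hθM : θ ≤ M) (hk : 0 < k)
    (hpos : 0 < excess (volume.restrict Ω) u 1 k) :
    excess (volume.restrict Ω) u 1 k ^ (p - 1) ≤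
      S ^ p * (μ / c) * (2 * M) ^ (q - 1) *
        levelMeas (volume.restrict Ω) u k ^ (p - 1 + p / N) := by
  have : IsFiniteMeasure (volume.restrict Ω) := ⟨by simpa using hΩ⟩
  have hc := hH.pos
  have hA : 0 ≤ levelMeas (volume.restrict Ω) u k := levelMeas_nonneg
  have hE : c * levelEnergy (volume.restrict Ω) p u Du k ≤
      μ * (2 * M) ^ (q - 1) * excess (volume.restrict Ω) u 1 k := by
    have hle := h.mul_levelEnergy_le_of_sign_mul_le hp hH hk
      ((integrable_max_sub (h.mem.integrable hp) k).const_mul (μ * (2 * M) ^ (q - 1))) (by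
        filter_upwards [hg, hM] with x hx hMx
        refine mul_le_mul_of_nonneg_right (hx.trans ?_) (le_max_right _ _)
        gcongr
        linarith)
    rwa [hH0, zero_mul, zero_add, integral_const_mul, ← excess_one] at hle
  rw [Real.rpow_sub_one hpos.ne', div_le_iff₀ hpos]
  calc excess (volume.restrict Ω) u 1 k ^ p
      ≤ S ^ p * levelMeas (volume.restrict Ω) u k ^ (p - 1 + p / N) *
          levelEnergy (volume.restrict Ω) p u Du k := hS Ω p u Du k hΩ hp h.mem hk
    _ ≤ S ^ p * levelMeas (volume.restrict Ω) u k ^ (p - 1 + p / N) *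
          (μ * (2 * M) ^ (q - 1) * excess (volume.restrict Ω) u 1 k / c) := by
        gcongr
        rwa [le_div_iff₀' hc]
    _ = _ := by ring

theorem lpNorm_top_le (hN : 1 ≤ N) (hS : IsExcessConst N S) (hS0 : 0 < S) (hΩ : volume Ω < ⊤)
    (hp : 1 ≤ p) (hH : CoerciveIntegrand p c H) (hH0 : H 0 = 0)
    (h : IsSourceMinimizer Ω p H g u Du) (hμ : 0 ≤ μ) (hθ : 0 ≤ θ) (hq : 1 ≤ q)
    (hqc : (q : EReal) < critExp N p)
    (hg : ∀ᵐ x ∂volume.restrict Ω, Real.sign (u x) * g x ≤ μ * (|u x| + θ) ^ (q - 1))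
    (hu : MemLp u ⊤ (volume.restrict Ω)) (hM : θ < lpNorm u ⊤ (volume.restrict Ω)) :
    lpNorm u ⊤ (volume.restrict Ω) ≤ boundConst N S p q *
      ((μ / c) ^ ((N : ℝ) / p) * ∫ x in Ω, |u x| ^ q) ^ (p / (p * q + (p - q) * N)) := by
  have : IsFiniteMeasure (volume.restrict Ω) := ⟨by simpa using hΩ⟩
  have : (0 : ℝ) < N := by exact_mod_cast hN
  have hpN : 0 < p / N := by positivity
  have hc := hH.pos
  have hδ := two_rpow_div_sub_one_pos hN hp
  set m := volume.restrict Ω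
  set D := p - 1 + p / N with hD
  obtain ⟨x, hx⟩ : ∃ x, lpNorm u ⊤ m = 2 * x := ⟨lpNorm u ⊤ m / 2, by ring⟩
  have hx0 : 0 < x := by linarith
  set B := S ^ p * (μ / c) * (4 * x) ^ (q - 1)
  have hφ : 0 ≤ excess m u 1 x := excess_nonneg
  have hexp : 1 - (p - 1) / D = p / N / D := by
    rw [one_sub_div (by linarith), hD]
    ring
  have hlevel : ∀ k, x ≤ k → 0 < excess m u 1 k →
      excess m u 1 k ^ (p - 1) ≤ B * levelMeas m u k ^ D := fun k hk hpos => by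
    have := h.excess_one_rpow_le hS hS0.le hΩ hp hH hH0 hμ hθ hq hg (ae_le_lpNorm_exponent_top hu)
      hM.le (hx0.trans_le hk) hpos
    rwa [hx, show 2 * (2 * x) = 4 * x by ring] at this
  have hae := ae_abs_le_of_excess_rpow_le (h.mem.integrable hp) (by linarith) (by linarith)
    (by positivity) hlevel
  rw [hexp] at hae
  have hsup : 2 * x ≤ x + B ^ (1 / D) * (excess m u 1 x ^ (p / N / D) / (2 ^ (p / N / D) - 1)) := by
    rw [← hx, ← ENNReal.ofReal_le_ofReal_iff (by positivity), ofReal_lpNorm hu,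
      eLpNorm_exponent_top]
    exact eLpNormEssSup_le_of_ae_bound hae
  rw [hx]
  refine two_mul_le_boundConst_mul hN hS0 hp hx0 (integral_nonneg fun _ => by positivity)
    (by positivity) (bound_exponent_pos hN hp hq hqc) ?_
  have : 0 ≤ ∫ y in Ω, |u y| ^ q := integral_nonneg fun _ => by positivity
  calc x ≤ B ^ (1 / D) * (excess m u 1 x ^ (p / N / D) / (2 ^ (p / N / D) - 1)) := by linarith
    _ ≤ _ := by
      gcongr
      exact excess_one_le_rpow_mul_integral hq (hu.mono_exponent le_top) hx0

theorem eLpNorm_top_le (hN : 1 ≤ N) (hS : IsExcessConst N S) (hS0 : 0 < S) (hΩ : volume Ω < ⊤)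
    (hp : 1 ≤ p) (hH : CoerciveIntegrand p c H) (hH0 : H 0 = 0)
    (h : IsSourceMinimizer Ω p H g u Du) (hμ : 0 ≤ μ) (hθ : 0 ≤ θ) (hq : 1 ≤ q)
    (hqc : (q : EReal) < critExp N p)
    (hg : ∀ᵐ x ∂volume.restrict Ω, Real.sign (u x) * g x ≤ μ * (|u x| + θ) ^ (q - 1)) :
    Integrable (fun x => |u x| ^ q) (volume.restrict Ω) ∧
      eLpNorm u ⊤ (volume.restrict Ω) ≤ ENNReal.ofReal (max θ (boundConst N S p q *
        ((μ / c) ^ ((N : ℝ) / p) * ∫ x in Ω, |u x| ^ q) ^ (p / (p * q + (p - q) * N)))) := by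
  have : IsFiniteMeasure (volume.restrict Ω) := ⟨by simpa using hΩ⟩
  have hu : MemLp u ⊤ (volume.restrict Ω) :=
    h.memLp_top hN hΩ hp hH fun _ => ⟨μ, θ, q, hμ, hθ, hqc.le, hg⟩
  have huq : MemLp u (ENNReal.ofReal q) (volume.restrict Ω) := hu.mono_exponent le_top
  refine ⟨?_, ?_⟩
  · simpa [ENNReal.toReal_ofReal (by linarith : 0 ≤ q)] using
      huq.integrable_norm_rpow (by simpa using by linarith) ENNReal.ofReal_ne_top
  · rw [← ofReal_lpNorm hu]
    refine ENNReal.ofReal_le_ofReal ((le_or_gt _ θ).elim (fun hle => le_max_of_le_left hle)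
      fun hlt => le_max_of_le_right ?_)
    exact h.lpNorm_top_le hN hS hS0 hΩ hp hH hH0 hμ hθ hq hqc hg hu hlt

end IsSourceMinimizer

end QuantitativeEstimate

theorem Standing.coerciveIntegrand {N : ℕ} {Ω : Set (RN N)} {p c : ℝ} {H : RN N → ℝ}
    {f : RN N → ℝ → ℝ} (h : Standing Ω p c H f) : CoerciveIntegrand p c H :=
  ⟨h.c_pos, h.convex.locallyLipschitz.continuous.measurable, h.coercive⟩

theorem IsEnergyCritical.isSourceMinimizer {N : ℕ} {Ω : Set (RN N)} {p : ℝ} {H : RN N → ℝ}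
    {f : RN N → ℝ → ℝ} {u : RN N → ℝ} {Du : RN N → RN N} (h : IsEnergyCritical Ω p H f u Du) :
    IsSourceMinimizer Ω p H (fun x => f x (u x)) u Du :=
  ⟨h.mem.1, h.mem.2, fun v Dv hv hfv => h.minimal v Dv ⟨hv, hfv⟩⟩

theorem theorem1p2_general (N : ℕ) (hN : 1 ≤ N) :
    (∀ (Ω : Set (RN N)) (p c : ℝ) (H : RN N → ℝ) (g u : RN N → ℝ) (Du : RN N → RN N),
        volume Ω < ⊤ → 1 ≤ p → CoerciveIntegrand p c H →
        (p ≤ (N : ℝ) → ∃ μ θ q : ℝ, 0 ≤ μ ∧ 0 ≤ θ ∧ (q : EReal) ≤ critExp N p ∧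
          ∀ᵐ x ∂volume.restrict Ω, Real.sign (u x) * g x ≤ μ * (|u x| + θ) ^ (q - 1)) →
        IsSourceMinimizer Ω p H g u Du →
        MemLp u ⊤ (volume.restrict Ω)) ∧
    (∃ C : ℝ → ℝ → ℝ,
        ContinuousOn (fun z : ℝ × ℝ => C z.1 z.2) (subcritical N) ∧
        (∀ z ∈ subcritical N, 0 < C z.1 z.2) ∧
        ∀ (Ω : Set (RN N)) (p c : ℝ) (H : RN N → ℝ) (g : RN N → ℝ) (μ θ q : ℝ)
          (u : RN N → ℝ) (Du : RN N → RN N),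
          volume Ω < ⊤ → 1 ≤ p → CoerciveIntegrand p c H → H 0 = 0 →
          0 ≤ μ → 0 ≤ θ → 1 ≤ q → (q : EReal) < critExp N p →
          (∀ᵐ x ∂volume.restrict Ω, Real.sign (u x) * g x ≤ μ * (|u x| + θ) ^ (q - 1)) →
          IsSourceMinimizer Ω p H g u Du →
          Integrable (fun x => |u x| ^ q) (volume.restrict Ω) ∧
          eLpNorm u ⊤ (volume.restrict Ω) ≤ ENNReal.ofReal
            (max θ (C p q * ((μ / c) ^ ((N : ℝ) / p) * ∫ x in Ω, |u x| ^ q) ^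
              (p / (p * q + (p - q) * (N : ℝ)))))) := by
  obtain ⟨S, hS0, hS⟩ := exists_isExcessConst hN
  refine ⟨fun Ω p c H g u Du hΩ hp hH hg h => h.memLp_top hN hΩ hp hH hg, boundConst N S,
    continuousOn_boundConst hN hS0, fun z hz => boundConst_pos hN hS0 hz.1, ?_⟩
  intro Ω p c H g μ θ q u Du hΩ hp hH hH0 hμ hθ hq hqc hg h
  exact h.eLpNorm_top_le hN hS hS0 hΩ hp hH hH0 hμ hθ hq hqc hg

theorem theorem1p2 (N : ℕ) (hN : 1 ≤ N) :
    -- every energy critical point is bounded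
    (∀ (Ω : Set (RN N)) (p c : ℝ) (H : RN N → ℝ) (f : RN N → ℝ → ℝ)
        (u : RN N → ℝ) (Du : RN N → RN N),
        Standing Ω p c H f →
        (p ≤ (N : ℝ) → ∃ μ θ q : ℝ, 0 ≤ μ ∧ 0 ≤ θ ∧ 1 ≤ q ∧ (q : EReal) ≤ critExp N p ∧
          OneSidedGrowth Ω f μ θ q) →
        IsEnergyCritical Ω p H f u Du →
        MemLp u ⊤ (volume.restrict Ω)) ∧
    -- the quantitative estimate in the subcritical case
    (∃ C : ℝ → ℝ → ℝ,
        ContinuousOn (fun z : ℝ × ℝ => C z.1 z.2) (subcritical N) ∧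
        (∀ z ∈ subcritical N, 0 < C z.1 z.2) ∧
        ∀ (Ω : Set (RN N)) (p c : ℝ) (H : RN N → ℝ) (f : RN N → ℝ → ℝ) (μ θ q : ℝ)
          (u : RN N → ℝ) (Du : RN N → RN N),
          Standing Ω p c H f → H 0 = 0 →
          0 ≤ μ → 0 ≤ θ → 1 ≤ q → (q : EReal) < critExp N p →
          OneSidedGrowth Ω f μ θ q →
          IsEnergyCritical Ω p H f u Du →
          Integrable (fun x => |u x| ^ q) (volume.restrict Ω) ∧
          eLpNorm u ⊤ (volume.restrict Ω) ≤ ENNReal.ofReal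
            (max θ (C p q * ((μ / c) ^ ((N : ℝ) / p) * ∫ x in Ω, |u x| ^ q) ^
              (p / (p * q + (p - q) * (N : ℝ)))))) := by
  obtain ⟨hbdd, C, hcont, hpos, hest⟩ := theorem1p2_general N hN
  refine ⟨?_, C, hcont, hpos, ?_⟩
  · intro Ω p c H f u Du hst hG hcrit
    refine hbdd Ω p c H _ u Du hst.finite_measure hst.one_le hst.coerciveIntegrand (fun hpN => ?_)
      hcrit.isSourceMinimizer
    obtain ⟨μ, θ, q, hμ, hθ, -, hqc, hG⟩ := hG hpN
    exact ⟨μ, θ, q, hμ, hθ, hqc, hG.mono fun x hx => hx (u x)⟩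
  · intro Ω p c H f μ θ q u Du hst hH0 hμ hθ hq hqc hG hcrit
    exact hest Ω p c H _ μ θ q u Du hst.finite_measure hst.one_le hst.coerciveIntegrand hH0
      hμ hθ hq hqc (hG.mono fun x hx => hx (u x)) hcrit.isSourceMinimizer
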